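/- Let $H(1,r)$ be the generalised Heisenberg group of real $(r+2)\times(r+2)$ matrices $\begin{pmatrix} I_r & A^t & B^t\\ 0&1&c\\ 0&0&1\end{pmatrix}$, $A=(a_1,\dots,a_r)$, $B=(b_1,\dots,b_r)\in\mathbb R^r$, $c\in\mathbb R$, with global coordinates $x^i=a_i$, $x^{r+i}=b_i$, $z=c$ $(1\le i\le r)$, endowed with the left-invariant Riemannian metric $\langle\cdot,\cdot\rangle$ for which the left-invariant fields $$X_i=\tfrac{\partial}{\partial x^i},\qquad X_{r+i}=\tfrac{\partial}{\partial x^{r+i}},\qquad Z=\tfrac{\partial}{\partial z}+\sum_{j=1}^r x^j\tfrac{\partial}{\partial x^{r+j}}$$ are orthonormal, and let $\nabla$ be its Levi-Civita connection. Let $(\varphi,\zeta=Z,\eta=dz)$ be a left-invariant almost contact structure compatible with the metric, i.e. $\varphi^2=-I+\eta\otimes\zeta$ and $\langle\varphi X,\varphi Y\rangle=\langle X,Y\rangle-\eta(X)\eta(Y)$, let $\varphi^l_k$ $(1\le k,l\le 2r)$ be its constant components, $\varphi X_k=\sum_l\varphi_k^lX_l$, and let $$\xi_X=-\tfrac12\,\varphi\circ\nabla_X\varphi+\nabla_X\eta\otimes\zeta-\tfrac12\,\eta\otimes\nabla_X\zeta$$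 be its intrinsic torsion as a $U(r)\times1$-structure. The structure is called harmonic if $d^*\xi=-\sum_i(\nabla_{e_i}\xi)_{e_i}=0$ ($\{e_i\}$ an orthonormal frame). It determines a section $\sigma$ of $\mathcal{SO}(H(1,r))/(U(r)\times 1)$, which carries the metric $\langle\pi_*\cdot,\pi_*\cdot\rangle+\langle\phi(\cdot),\phi(\cdot)\rangle$, where $\pi$ is the projection to $H(1,r)$ and $\phi$ takes the vertical part, identified with an element of $\mathfrak u(r)^\perp\subset\mathfrak{so}(2r+1)$ and measured by the norm of $(1,1)$-tensors, in the splitting of the tangent bundle induced by $\nabla$. The structure determines a harmonic map if $\sigma$ is a harmonic map of Riemannian manifolds, that is, a critical point of the energy $\frac12\int\|f_*\|^2\,dv$ with respect to all smooth compactly supported variations through maps $f:H(1,r)\to\mathcal{SO}(H(1,r))/(U(r)\times1)$. Then: (a) If the structure $(\varphi,\zeta=Z,\eta=dz)$ is harmonic, then it determines a harmonic map. (b) The following conditions are equivalent: (i) the structure is harmonic; (ii) for all $i,j\in\{1,\dots,r\}$, $$\langle\xi_ZX_i,X_j\rangle=\langle\xi_ZX_{r+i},X_{r+j}\rangle,\qquad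 \langle\xi_ZX_i,X_{r+j}\rangle=\langle\xi_ZX_j,X_{r+i}\rangle;$$ (iii) for all $i,j\in\{1,\dots,r\}$, $$\sum_{k=1}^r\{(\varphi_j^{r+k}+\varphi_{r+j}^k)(\varphi_i^k+\varphi_{r+i}^{r+k})+(\varphi_{r+j}^{r+k}-\varphi_j^k)(\varphi_i^{r+k}-\varphi_{r+i}^k)\}=0,$$ $$\sum_{k=1}^r\{\varphi_i^k\varphi_{r+j}^{r+k}-\varphi_i^{r+k}\varphi_{r+j}^k+\varphi_j^{r+k}\varphi_{r+i}^k-\varphi_j^k\varphi_{r+i}^{r+k}\}=0.$$ -/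

import Mathlib

open scoped ContDiff Matrix
open MeasureTheory

noncomputable section

namespace Heisenberg

/-! ### The group `H(1,r)` in its global coordinates -/

/-- Index set of the `2r+1` coordinates `x^i`, `x^{r+i}`, `z`, and of the frame
`X_i`, `X_{r+i}`, `Z`. -/
abbrev Idx (r : ℕ) := Fin r ⊕ Fin r ⊕ Unit

/-- The index of `x^i` and `X_i`. -/
abbrev iX {r : ℕ} (i : Fin r) : Idx r := Sum.inl i
/-- The index of `x^{r+i}` and `X_{r+i}`. -/
abbrev iY {r : ℕ} (i : Fin r) : Idx r := Sum.inr (Sum.inl i)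
/-- The index of `z` and `Z`. -/
abbrev iZ {r : ℕ} : Idx r := Sum.inr (Sum.inr ())

/-- Points of `H(1,r)` in global coordinates; this is also each tangent space. -/
abbrev Pt (r : ℕ) := Idx r → ℝ

variable {r : ℕ}

/-- The matrix with coordinates `p`: rows `(I_r, Aᵗ, Bᵗ)`, `(0, 1, c)`, `(0, 0, 1)`. -/
def toMatrix (p : Pt r) : Matrix (Fin r ⊕ Unit ⊕ Unit) (Fin r ⊕ Unit ⊕ Unit) ℝ
  | Sum.inl i, Sum.inl j => if i = j then 1 else 0
  | Sum.inl i, Sum.inr (Sum.inl _) => p (iX i)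
  | Sum.inl i, Sum.inr (Sum.inr _) => p (iY i)
  | Sum.inr (Sum.inl _), Sum.inl _ => 0
  | Sum.inr (Sum.inl _), Sum.inr (Sum.inl _) => 1
  | Sum.inr (Sum.inl _), Sum.inr (Sum.inr _) => p iZ
  | Sum.inr (Sum.inr _), Sum.inl _ => 0
  | Sum.inr (Sum.inr _), Sum.inr (Sum.inl _) => 0
  | Sum.inr (Sum.inr _), Sum.inr (Sum.inr _) => 1

/-- The group law of `H(1,r)` in coordinates. -/
def mul (p q : Pt r) : Pt r
  | Sum.inl i => p (iX i) + q (iX i)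
  | Sum.inr (Sum.inl i) => p (iY i) + q (iY i) + p (iX i) * q iZ
  | Sum.inr (Sum.inr _) => p iZ + q iZ

/-- `mul` is matrix multiplication. -/
theorem toMatrix_mul (p q : Pt r) : toMatrix (mul p q) = toMatrix p * toMatrix q := by
  ext a b
  rcases a with i | u | u <;> rcases b with j | v | v <;>
    simp [Matrix.mul_apply, toMatrix, mul, add_comm, add_left_comm, add_assoc]

/-- The coordinates determine the matrix and conversely. -/
theorem toMatrix_injective : Function.Injective (toMatrix (r := r)) := by
  intro p q h
  funext k
  rcases k with i | i | u
  · exact congrFun (congrFun h (Sum.inl i)) (Sum.inr (Sum.inl ()))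
  · exact congrFun (congrFun h (Sum.inl i)) (Sum.inr (Sum.inr ()))
  · exact congrFun (congrFun h (Sum.inr (Sum.inl ()))) (Sum.inr (Sum.inr ()))

/-! ### Left-invariant frame, metric, Levi-Civita connection -/

/-- The fields `X_i = ∂/∂x^i`, `X_{r+i} = ∂/∂x^{r+i}`, `Z = ∂/∂z + ∑ x^j ∂/∂x^{r+j}`. -/
def frame : Idx r → Pt r → Pt r
  | Sum.inl i, _ => Pi.single (iX i) 1
  | Sum.inr (Sum.inl i), _ => Pi.single (iY i) 1
  | Sum.inr (Sum.inr _), p => Pi.single iZ 1 + ∑ j, p (iX j) • Pi.single (iY j) 1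

/-- The dual one-forms `dx^i`, `dx^{r+i} - x^i dz`, `dz`. -/
def coframe : Idx r → Pt r → Pt r → ℝ
  | Sum.inl i, _, v => v (iX i)
  | Sum.inr (Sum.inl i), p, v => v (iY i) - p (iX i) * v iZ
  | Sum.inr (Sum.inr _), _, v => v iZ

theorem coframe_frame (k l : Idx r) (p : Pt r) :
    coframe k p (frame l p) = if k = l then 1 else 0 := by
  rcases k with i | i | u <;> rcases l with j | j | v <;>
    simp [coframe, frame, Pi.single_apply, Finset.sum_apply]

theorem coframe_add (k : Idx r) (p v w : Pt r) :
    coframe k p (v + w) = coframe k p v + coframe k p w := by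
  rcases k with i | i | u <;> simp [coframe] <;> ring

theorem coframe_smul (k : Idx r) (p : Pt r) (c : ℝ) (v : Pt r) :
    coframe k p (c • v) = c * coframe k p v := by
  rcases k with i | i | u <;> simp [coframe] <;> ring

theorem sum_coframe_smul_frame (p v : Pt r) : ∑ k, coframe k p v • frame k p = v := by
  funext l
  rcases l with j | j | u <;>
    simp [coframe, frame, Fintype.sum_sum_type, Finset.sum_apply, Pi.single_apply] <;> ring

/-- The differential at `p` of the left translation by `a`. -/
def dL (a p : Pt r) : Pt r →L[ℝ] Pt r := fderiv ℝ (mul a) p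

/-- The Riemannian metric for which the frame is orthonormal. In the given coordinates its
volume measure is Lebesgue measure, since the coframe has determinant one. -/
def metric (p v w : Pt r) : ℝ := ∑ k, coframe k p v * coframe k p w

theorem metric_frame (p v : Pt r) (k : Idx r) : metric p v (frame k p) = coframe k p v := by
  simp [metric, coframe_frame]

theorem det_coframe (p : Pt r) :
    (Matrix.of fun k l : Idx r => coframe k p (Pi.single l 1)).det = 1 := by
  have h : (Matrix.of fun k l : Idx r => coframe k p (Pi.single l 1))
      = Matrix.fromBlocks 1 0 0
          (Matrix.fromBlocks 1 (Matrix.of fun i (_ : Unit) => -p (iX i)) 0 1) := by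
    ext k l
    rcases k with i | i | u <;> rcases l with j | j | v <;>
      simp [coframe, Pi.single_apply, Matrix.one_apply]
  rw [h, Matrix.det_fromBlocks_zero₂₁, Matrix.det_fromBlocks_zero₂₁]
  simp

/-- The frame is left-invariant. -/
theorem dL_frame (a p : Pt r) (k : Idx r) : dL a p (frame k p) = frame k (mul a p) := by
  have hd : DifferentiableAt ℝ (mul a) p := by
    refine differentiableAt_pi.2 fun l => ?_
    rcases l with i | i | u <;> simp only [mul] <;> fun_prop
  have hk : ∀ v l, dL a p v l = fderiv ℝ (fun q => mul a q l) p v := by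
    intro v l
    have h := (hasFDerivAt_pi'.1 hd.hasFDerivAt l).fderiv
    rw [h]
    rfl
  have hp : ∀ (l : Idx r) (v : Pt r), fderiv ℝ (fun q : Pt r => q l) p v = v l := by
    intro l v
    rw [(hasFDerivAt_apply l p).fderiv]
    rfl
  have hX : ∀ i v, dL a p v (iX i) = v (iX i) := by
    intro i v
    rw [hk]
    simp only [mul]
    rw [fderiv_const_add, hp]
  have hY : ∀ i v, dL a p v (iY i) = v (iY i) + a (iX i) * v iZ := by
    intro i v
    rw [hk]
    simp only [mul]
    rw [fderiv_fun_add (by fun_prop) (by fun_prop), fderiv_const_add,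
      fderiv_const_mul (by fun_prop)]
    simp [hp]
  have hZ : ∀ v, dL a p v iZ = v iZ := by
    intro v
    rw [hk]
    simp only [mul]
    rw [fderiv_const_add, hp]
  funext l
  rcases l with i | i | u
  · rw [hX]
    rcases k with j | j | w <;> simp [frame, Pi.single_apply, Finset.sum_apply]
  · rw [hY]
    rcases k with j | j | w <;>
      simp [frame, mul, Pi.single_apply, Finset.sum_apply, add_comm]
  · rw [hZ]
    rcases k with j | j | w <;> simp [frame, Pi.single_apply, Finset.sum_apply]

/-- Koszul's expression for `⟨∇_V W, U⟩`. -/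
def koszul (V W U : Pt r → Pt r) (p : Pt r) : ℝ :=
  (1 / 2) *
    (fderiv ℝ (fun q => metric q (W q) (U q)) p (V p)
      + fderiv ℝ (fun q => metric q (V q) (U q)) p (W p)
      - fderiv ℝ (fun q => metric q (V q) (W q)) p (U p)
      + metric p (VectorField.lieBracket ℝ V W p) (U p)
      - metric p (VectorField.lieBracket ℝ W U p) (V p)
      + metric p (VectorField.lieBracket ℝ U V p) (W p))

/-- The Levi-Civita connection `∇_V W` on (differentiable) vector fields. -/
def nabla (V W : Pt r → Pt r) (p : Pt r) : Pt r :=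
  ∑ k, koszul V W (frame k) p • frame k p

/-! ### Almost contact metric structures, intrinsic torsion, harmonicity -/

/-- Almost contact structures `(φ, ζ, η = ζ^♭)` on `H(1,r)` compatible with the metric. -/
structure AlmostContactMetric (r : ℕ) where
  φ : Pt r → Pt r →L[ℝ] Pt r
  ζ : Pt r → Pt r
  smooth_φ : ContDiff ℝ ∞ φ
  smooth_ζ : ContDiff ℝ ∞ ζ
  unit : ∀ p, metric p (ζ p) (ζ p) = 1
  sq : ∀ p v, φ p (φ p v) = -v + metric p (ζ p) v • ζ p
  compat : ∀ p v w,
    metric p (φ p v) (φ p w) = metric p v w - metric p (ζ p) v * metric p (ζ p) w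

namespace AlmostContactMetric

/-- Invariance of `φ` and `ζ` under all left translations. -/
def IsLeftInvariant (S : AlmostContactMetric r) : Prop :=
  (∀ a p v, S.φ (mul a p) (dL a p v) = dL a p (S.φ p v)) ∧
    ∀ a p, S.ζ (mul a p) = dL a p (S.ζ p)

/-- The one-form `η = ζ^♭`, applied to a vector field. -/
def η (S : AlmostContactMetric r) (W : Pt r → Pt r) (p : Pt r) : ℝ := metric p (S.ζ p) (W p)

/-- `(∇_V φ) W`. -/
def nablaPhi (S : AlmostContactMetric r) (V W : Pt r → Pt r) (p : Pt r) : Pt r :=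
  nabla V (fun q => S.φ q (W q)) p - S.φ p (nabla V W p)

/-- `(∇_V η) W`. -/
def nablaEta (S : AlmostContactMetric r) (V W : Pt r → Pt r) (p : Pt r) : ℝ :=
  fderiv ℝ (S.η W) p (V p) - S.η (nabla V W) p

/-- The intrinsic torsion
`ξ_V = -½ φ ∘ ∇_V φ + ∇_V η ⊗ ζ - ½ η ⊗ ∇_V ζ`, applied to `W`. -/
def xi (S : AlmostContactMetric r) (V W : Pt r → Pt r) (p : Pt r) : Pt r :=
  -((1 / 2 : ℝ) • S.φ p (S.nablaPhi V W p)) + S.nablaEta V W p • S.ζ p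
    - ((1 / 2 : ℝ) * S.η W p) • nabla V S.ζ p

/-- The coderivative `d^*ξ = -∑ (∇_{e_i} ξ)_{e_i}`, applied to `W`. -/
def dstarXi (S : AlmostContactMetric r) (W : Pt r → Pt r) (p : Pt r) : Pt r :=
  -∑ i, (nabla (frame i) (S.xi (frame i) W) p
      - S.xi (nabla (frame i) (frame i)) W p
      - S.xi (frame i) (nabla (frame i) W) p)

/-- The structure is harmonic: the tensor field `d^*ξ` vanishes (on a frame, hence on all
vectors). -/
def IsHarmonic (S : AlmostContactMetric r) : Prop :=
  ∀ k p, S.dstarXi (frame k) p = 0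

/-- The component `φ^l_k` of `φ`, given by `φ e_k = ∑ φ^l_k e_l`. -/
def comp (S : AlmostContactMetric r) (l k : Idx r) (p : Pt r) : ℝ :=
  coframe l p (S.φ p (frame k p))

/-- The component `ζ^k` of `ζ`. -/
def compZeta (S : AlmostContactMetric r) (p : Pt r) (k : Idx r) : ℝ := coframe k p (S.ζ p)

end AlmostContactMetric

/-! ### The quotient bundle `SO(M)/(U(r) × 1)` and its metric -/

/-- Linear almost contact metric structures on Euclidean space `ℝ^{2r+1}`. -/
structure IsLinearACM (A : Matrix (Idx r) (Idx r) ℝ) (w : Idx r → ℝ) : Prop where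
  unit : w ⬝ᵥ w = 1
  sq : A * A = -1 + Matrix.vecMulVec w w
  compat : Aᵀ * A = 1 - Matrix.vecMulVec w w

/-- The total space of `SO(M)/(U(r) × 1)`, `M = H(1,r)`: a class of orthonormal frames of `T_pM`
modulo `U(r) × 1` is the almost contact metric structure on `T_pM` which it determines. The latter
is written here in components with respect to the left-invariant frame. Both orientations are
allowed; a continuous map from the connected space `M` stays in one of them. -/
structure QuotientBundle (r : ℕ) where
  pt : Pt r
  phi : Matrix (Idx r) (Idx r) ℝ
  zeta : Idx r → ℝ
  isACM : IsLinearACM phi zeta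

/-- Matrix of the endomorphism `u ↦ ∇_v u` of `T_pM` on left-invariant `u`: the connection
form of the Levi-Civita connection in the left-invariant frame. -/
def connMatrix (p v : Pt r) : Matrix (Idx r) (Idx r) ℝ :=
  Matrix.of fun k j => ∑ i, coframe i p v * metric p (nabla (frame i) (frame j) p) (frame k p)

/-- `a` is the element of `u(r)^⊥` (the orthogonal complement in `so(2r+1)` of the Lie algebra of
the stabiliser of `(A, w)`) whose infinitesimal action on `(A, w)` is `(A', w')`. -/
structure IsVerticalPart (A : Matrix (Idx r) (Idx r) ℝ) (w : Idx r → ℝ)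
    (A' : Matrix (Idx r) (Idx r) ℝ) (w' : Idx r → ℝ) (a : Matrix (Idx r) (Idx r) ℝ) : Prop where
  skew : aᵀ = -a
  orth : ∀ b : Matrix (Idx r) (Idx r) ℝ, bᵀ = -b → b * A = A * b → b *ᵥ w = 0 →
    (a * b).trace = 0
  phi : a * A - A * a = A'
  zeta : a *ᵥ w = w'

/-- An explicit formula for the element described by `IsVerticalPart`. -/
def vert (A : Matrix (Idx r) (Idx r) ℝ) (w : Idx r → ℝ)
    (A' : Matrix (Idx r) (Idx r) ℝ) (w' : Idx r → ℝ) : Matrix (Idx r) (Idx r) ℝ :=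
  (1 / 2 : ℝ) • (A * A') - Matrix.vecMulVec w w' + (1 / 2 : ℝ) • Matrix.vecMulVec w' w

/-- The linear map underlying a one-form of the coframe. -/
def coframeL (k : Idx r) (p : Pt r) : Pt r →ₗ[ℝ] ℝ where
  toFun := coframe k p
  map_add' := coframe_add k p
  map_smul' c v := by simp [coframe_smul]

theorem coframe_sum_smul (k : Idx r) (p : Pt r) (c : Idx r → ℝ) (f : Idx r → Pt r) :
    coframe k p (∑ m, c m • f m) = ∑ m, c m * coframe k p (f m) := by
  change coframeL k p (∑ m, c m • f m) = _
  simp only [map_sum, map_smul, smul_eq_mul]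
  rfl

namespace IsLinearACM

variable {A : Matrix (Idx r) (Idx r) ℝ} {w : Idx r → ℝ}

theorem mulVec_eq_zero (h : IsLinearACM A w) : A *ᵥ w = 0 := by
  have h1 : (A *ᵥ w) ⬝ᵥ (A *ᵥ w) = 0 := by
    rw [Matrix.dotProduct_mulVec, Matrix.vecMul_mulVec, ← Matrix.dotProduct_mulVec, h.compat,
      Matrix.sub_mulVec, Matrix.one_mulVec, Matrix.vecMulVec_mulVec, h.unit]
    simp
  exact dotProduct_self_eq_zero.mp h1

theorem vecMul_eq_zero (h : IsLinearACM A w) : w ᵥ* A = 0 := by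
  have h1 : A * (A * A) = (A * A) * A := (mul_assoc A A A).symm
  rw [h.sq, mul_add, add_mul, Matrix.mul_vecMulVec, Matrix.vecMulVec_mul, h.mulVec_eq_zero] at h1
  have h2 : Matrix.vecMulVec w (w ᵥ* A) = 0 := by simpa using h1.symm
  have h3 := congrArg (fun M => w ᵥ* M) h2
  simpa [Matrix.vecMul_vecMulVec, h.unit] using h3

theorem skew (h : IsLinearACM A w) : Aᵀ = -A := by
  have h1 : (Aᵀ + A) * A = 0 := by
    rw [add_mul, h.compat, h.sq]; abel
  have h2 : (Aᵀ + A) * (A * A) = 0 := by rw [← mul_assoc, h1, zero_mul]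
  rw [h.sq, mul_add, Matrix.mul_vecMulVec, Matrix.add_mulVec, h.mulVec_eq_zero,
    Matrix.mulVec_transpose, h.vecMul_eq_zero] at h2
  have h3 : Aᵀ + A = 0 := by
    rw [mul_neg, mul_one, add_zero, Matrix.zero_vecMulVec, add_zero] at h2
    exact neg_eq_zero.mp h2
  exact eq_neg_of_add_eq_zero_left h3

end IsLinearACM

/-- On vectors `(A', w')` tangent to the space of linear almost contact metric structures,
`vert` has the property that defines the vertical part. -/
theorem isVerticalPart_vert {A A' : Matrix (Idx r) (Idx r) ℝ} {w w' : Idx r → ℝ}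
    (h : IsLinearACM A w) (hskew : A'ᵀ = -A')
    (hsq : A' * A + A * A' = Matrix.vecMulVec w' w + Matrix.vecMulVec w w')
    (hunit : w ⬝ᵥ w' = 0) : IsVerticalPart A w A' w' (vert A w A' w') := by
  have hA := h.skew
  have e1 := h.mulVec_eq_zero
  have e2 := h.vecMul_eq_zero
  have hAA : A * (A * A') = -A' + Matrix.vecMulVec w (w ᵥ* A') := by
    rw [← mul_assoc, h.sq, add_mul, Matrix.vecMulVec_mul]; simp
  have hAw : A' *ᵥ w = -(A *ᵥ w') := by
    have h0 : w ⬝ᵥ (A' *ᵥ w) = 0 := by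
      have : w ⬝ᵥ (A' *ᵥ w) = -(w ⬝ᵥ (A' *ᵥ w)) := by
        conv_lhs => rw [Matrix.dotProduct_mulVec, ← Matrix.mulVec_transpose, hskew,
          Matrix.neg_mulVec, neg_dotProduct, dotProduct_comm]
      linarith
    have h1 := congrArg (fun M => A *ᵥ (M *ᵥ w)) hsq
    simp only [Matrix.add_mulVec, ← Matrix.mulVec_mulVec, e1, Matrix.mulVec_zero, zero_add,
      Matrix.vecMulVec_mulVec, h.unit, dotProduct_comm w' w, hunit] at h1
    rw [Matrix.mulVec_mulVec, h.sq, Matrix.add_mulVec, Matrix.vecMulVec_mulVec, h0] at h1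
    simp only [Matrix.neg_mulVec, Matrix.one_mulVec, MulOpposite.op_zero, zero_smul,
      MulOpposite.op_one, one_smul, add_zero] at h1
    rw [← h1, neg_neg]
  have hwA' : w ᵥ* A' = A *ᵥ w' := by
    rw [← Matrix.mulVec_transpose, hskew, Matrix.neg_mulVec, hAw, neg_neg]
  have hw'A : w' ᵥ* A = -(A *ᵥ w') := by
    rw [← Matrix.mulVec_transpose, hA, Matrix.neg_mulVec]
  have hAAw : A *ᵥ (A *ᵥ w') = -w' := by
    rw [Matrix.mulVec_mulVec, h.sq, Matrix.add_mulVec, Matrix.vecMulVec_mulVec, hunit]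
    simp [Matrix.neg_mulVec]
  have hAA'A : A * A' * A = Matrix.vecMulVec (A *ᵥ w') w + A'
      - Matrix.vecMulVec w (A *ᵥ w') := by
    rw [mul_assoc, eq_sub_of_add_eq hsq, mul_sub, mul_add, Matrix.mul_vecMulVec,
      Matrix.mul_vecMulVec, e1, hAA, hwA', Matrix.zero_vecMulVec]
    abel
  refine ⟨?_, ?_, ?_, ?_⟩
  · have h1 : A' * A = Matrix.vecMulVec w' w + Matrix.vecMulVec w w' - A * A' :=
      eq_sub_of_add_eq hsq
    simp only [vert, Matrix.transpose_add, Matrix.transpose_sub, Matrix.transpose_smul,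
      Matrix.transpose_mul, Matrix.transpose_vecMulVec, hA, hskew, neg_mul_neg, h1]
    module
  · intro b hb hbA hbw
    have hwb : w ᵥ* b = 0 := by
      rw [← Matrix.mulVec_transpose, hb, Matrix.neg_mulVec, hbw, neg_zero]
    have t1 : (Matrix.vecMulVec w w' * b).trace = 0 := by
      rw [Matrix.vecMulVec_mul, Matrix.trace_vecMulVec, dotProduct_comm,
        ← Matrix.dotProduct_mulVec, hbw, dotProduct_zero]
    have t2 : (Matrix.vecMulVec w' w * b).trace = 0 := by
      rw [Matrix.vecMulVec_mul, hwb, Matrix.trace_vecMulVec, dotProduct_zero]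
    have t3 : (A' * A * b).trace = (A * A' * b).trace := by
      rw [mul_assoc, ← hbA, ← mul_assoc, Matrix.trace_mul_comm, mul_assoc]
    have t4 := congrArg (fun M => (M * b).trace) hsq
    simp only [add_mul, Matrix.trace_add, t1, t2, t3] at t4
    simp only [vert, add_mul, sub_mul, Matrix.smul_mul, Matrix.trace_add, Matrix.trace_sub,
      Matrix.trace_smul, t1, t2, smul_eq_mul]
    linarith
  · simp only [vert, add_mul, sub_mul, mul_add, mul_sub, Matrix.smul_mul, Matrix.mul_smul,
      Matrix.vecMulVec_mul, Matrix.mul_vecMulVec, hAA'A, hAA, e1, e2, hwA', hw'A,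
      Matrix.vecMulVec_zero, Matrix.zero_vecMulVec, Matrix.vecMulVec_neg]
    module
  · simp only [vert, Matrix.add_mulVec, Matrix.sub_mulVec, Matrix.smul_mulVec,
      ← Matrix.mulVec_mulVec, hAw, Matrix.mulVec_neg, hAAw, Matrix.vecMulVec_mulVec,
      dotProduct_comm w' w, hunit, h.unit, MulOpposite.op_zero, zero_smul, MulOpposite.op_one,
      one_smul]
    module

/-- The vertical part is unique. -/
theorem IsVerticalPart.eq {A A' : Matrix (Idx r) (Idx r) ℝ} {w w' : Idx r → ℝ}
    {a b : Matrix (Idx r) (Idx r) ℝ} (ha : IsVerticalPart A w A' w' a)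
    (hb : IsVerticalPart A w A' w' b) : a = b := by
  have hs : (a - b)ᵀ = -(a - b) := by
    rw [Matrix.transpose_sub, ha.skew, hb.skew]; abel
  have hc : (a - b) * A = A * (a - b) := by
    rw [sub_mul, mul_sub, sub_eq_sub_iff_sub_eq_sub, ha.phi, hb.phi]
  have hw : (a - b) *ᵥ w = 0 := by
    rw [Matrix.sub_mulVec, ha.zeta, hb.zeta, sub_self]
  have h0 : ((a - b)ᵀ * (a - b)).trace = 0 := by
    have h1 := ha.orth _ hs hc hw
    have h2 := hb.orth _ hs hc hw
    rw [hs, neg_mul, Matrix.trace_neg, sub_mul, Matrix.trace_sub, h1, h2]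
    simp
  rw [← Matrix.conjTranspose_eq_transpose_of_trivial] at h0
  exact sub_eq_zero.mp (Matrix.trace_conjTranspose_mul_self_eq_zero_iff.mp h0)

/-- The components of an almost contact metric structure form a linear one. -/
theorem AlmostContactMetric.isLinearACM (S : AlmostContactMetric r) (p : Pt r) :
    IsLinearACM (Matrix.of fun l k => S.comp l k p) (S.compZeta p) where
  unit := S.unit p
  sq := by
    ext l k
    have h := congrArg (coframe l p) (S.sq p (frame k p))
    have e : S.φ p (S.φ p (frame k p))
        = ∑ m, coframe m p (S.φ p (frame k p)) • S.φ p (frame m p) := by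
      conv_lhs => rw [← sum_coframe_smul_frame p (S.φ p (frame k p))]
      simp only [map_sum, map_smul]
    rw [e, coframe_sum_smul, coframe_add, coframe_smul, ← neg_one_smul ℝ, coframe_smul,
      coframe_frame, metric_frame] at h
    simp only [Matrix.mul_apply, Matrix.of_apply, AlmostContactMetric.comp, Matrix.add_apply, Matrix.neg_apply,
      Matrix.one_apply, Matrix.vecMulVec_apply, AlmostContactMetric.compZeta]
    simp only [mul_comm (coframe l p _) (coframe _ p (S.φ p (frame k p)))]
    rw [h]
    ring
  compat := by
    ext l k
    have h := S.compat p (frame l p) (frame k p)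
    rw [metric_frame, metric_frame, metric_frame, coframe_frame] at h
    simp only [Matrix.mul_apply, Matrix.of_apply, AlmostContactMetric.comp, Matrix.sub_apply,
      Matrix.one_apply, Matrix.vecMulVec_apply, AlmostContactMetric.compZeta,
      Matrix.transpose_apply]
    rw [metric] at h
    rw [h]
    simp only [eq_comm]

/-! ### Harmonic maps into the quotient bundle -/

/-- The section of the quotient bundle determined by an almost contact metric structure. -/
def AlmostContactMetric.toSection (S : AlmostContactMetric r) (p : Pt r) : QuotientBundle r where
  pt := p
  phi := Matrix.of fun l k => S.comp l k p
  zeta := S.compZeta p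
  isACM := S.isLinearACM p

/-- Projection to the base of the differential of `f` at `p` on `v`. -/
def baseDeriv (f : Pt r → QuotientBundle r) (p v : Pt r) : Pt r :=
  fderiv ℝ (fun q => (f q).pt) p v

/-- Covariant derivative along the base map of the endomorphism part of `f`. -/
def covPhi (f : Pt r → QuotientBundle r) (p v : Pt r) : Matrix (Idx r) (Idx r) ℝ :=
  Matrix.of (fun l k => fderiv ℝ (fun q => (f q).phi l k) p v)
    + (connMatrix (f p).pt (baseDeriv f p v) * (f p).phi
      - (f p).phi * connMatrix (f p).pt (baseDeriv f p v))

/-- Covariant derivative along the base map of the vector part of `f`. -/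
def covZeta (f : Pt r → QuotientBundle r) (p v : Pt r) : Idx r → ℝ :=
  (fun k => fderiv ℝ (fun q => (f q).zeta k) p v)
    + connMatrix (f p).pt (baseDeriv f p v) *ᵥ (f p).zeta

/-- The vertical part, an element of `u(r)^⊥`, of the differential of `f` at `p` on `v`, for the
splitting of the tangent bundle of `SO(M)/(U(r) × 1)` induced by the Levi-Civita connection. -/
def vertDeriv (f : Pt r → QuotientBundle r) (p v : Pt r) : Matrix (Idx r) (Idx r) ℝ :=
  vert (f p).phi (f p).zeta (covPhi f p v) (covZeta f p v)

/-- `‖f_*‖²` at `p`: the metric of the quotient bundle is the metric of the base on the projection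
plus the norm of `(1,1)`-tensors on the vertical part. -/
def normSqDeriv (f : Pt r → QuotientBundle r) (p : Pt r) : ℝ :=
  ∑ i, (metric (f p).pt (baseDeriv f p (frame i p)) (baseDeriv f p (frame i p))
    + ∑ k, ∑ l, vertDeriv f p (frame i p) k l ^ 2)

/-- The energy of `f` on `K`. -/
def energy (K : Set (Pt r)) (f : Pt r → QuotientBundle r) : ℝ :=
  (1 / 2) * ∫ p in K, normSqDeriv f p

/-- Smoothness of a map into the quotient bundle. -/
def SmoothInto {E : Type*} [NormedAddCommGroup E] [NormedSpace ℝ E]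
    (f : E → QuotientBundle r) : Prop :=
  ContDiff ℝ ∞ (fun x => (f x).pt) ∧ (∀ l k, ContDiff ℝ ∞ fun x => (f x).phi l k) ∧
    ∀ k, ContDiff ℝ ∞ fun x => (f x).zeta k

/-- `f` is a harmonic map: it is smooth and a critical point of the energy with respect to all
smooth compactly supported variations through maps `H(1,r) → SO(M)/(U(r) × 1)`. -/
def IsHarmonicMap (f : Pt r → QuotientBundle r) : Prop :=
  SmoothInto f ∧
    ∀ F : ℝ → Pt r → QuotientBundle r, SmoothInto (fun x : ℝ × Pt r => F x.1 x.2) → F 0 = f →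
      ∀ K : Set (Pt r), IsCompact K → (∀ t, ∀ p, p ∉ K → F t p = f p) →
        HasDerivAt (fun t => energy K (F t)) 0 0

end Heisenberg

end

/-! In the left-invariant frame everything becomes constant linear algebra. The structure is a fixed
matrix `A` with `ζ = Z`. The connection ∇_a is the skew matrix `conn a`, half of (s(a) ⊗ Z - Z ⊗
s(a) + a_Z J), where s exchanges the components along X_i and X_{r+i} and J is `rot`.

Harmonicity. For horizontal a, `conn a` interchanges Z and its complement, so it already lies in
u(r)^⊥ and ξ_a = -`conn a`. For a = Z one finds ξ_Z = -¼ A[J, A]. Since ∇_{e_i} e_i = 0, d^*ξ is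
minus the sum of the commutators of `conn e_i` with ξ_{e_i}. The horizontal terms cancel, and
harmonicity becomes the single equation [J, A[J, A]] = 0 (`isHarmonic_iff`). Read entrywise it is
(ii); expanding A[J, A] = A J A + J and using the orthogonality of the columns of `A` turns it into
(iii).

Harmonic map. The same frame trivialises the quotient bundle, and the vertical norm is ¼|Dφ|² +
(3/2)|Dζ|² (`IsTangent.frob_vert`). Variations may move the base point as well; let Y be the base
variation and (A', w') the fibre variation. The first variation of the density is a sum of
derivatives e_i(G_i), with G_i of compact support, plus zero-order terms in [e_i, Y] and in (A',
w'). The derivatives integrate to zero because the frame fields are divergence free. The terms in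
[e_i, Y] always vanish (`sum_horizontal_variation`). In the terms in (A', w') the horizontal
directions add up to a multiple of tr(A'A) = 0, and the direction Z leaves a multiple of ⟨[J, A],
[J, A']⟩ = tr([J, [J, A]] A'). Harmonicity makes [J, [J, A]] commute with `A`, while A' anticommutes
with `A` up to terms in Z; hence this trace equals its own negative (`frob_rot_rot_commutator`). -/

namespace Heisenberg

variable {r : ℕ}

/-! ### Left-invariant vector fields and the connection -/

/-- The left-invariant field with components `a`. -/
noncomputable def leftField (a : Idx r → ℝ) (p : Pt r) : Pt r := ∑ k, a k • frame k p

theorem coframe_leftField (k : Idx r) (a : Idx r → ℝ) (p : Pt r) :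
    coframe k p (leftField a p) = a k := by
  rw [leftField, coframe_sum_smul]
  simp only [coframe_frame, mul_ite, mul_one, mul_zero, Finset.sum_ite_eq, Finset.mem_univ, if_true]

theorem leftField_coframe (p v : Pt r) : leftField (fun k => coframe k p v) p = v :=
  sum_coframe_smul_frame p v

theorem frame_eq_leftField (k : Idx r) : frame k = leftField (Pi.single k 1) := by
  funext p
  simp [leftField, Pi.single_apply]

theorem metric_leftField (a b : Idx r → ℝ) (p : Pt r) :
    metric p (leftField a p) (leftField b p) = a ⬝ᵥ b := by
  simp [metric, coframe_leftField, dotProduct]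

theorem leftField_add (a b : Idx r → ℝ) (p : Pt r) :
    leftField (a + b) p = leftField a p + leftField b p := by
  simp [leftField, add_smul, Finset.sum_add_distrib]

theorem leftField_smul (c : ℝ) (a : Idx r → ℝ) (p : Pt r) :
    leftField (c • a) p = c • leftField a p := by
  simp [leftField, Finset.smul_sum, smul_smul]

theorem leftField_zero (p : Pt r) : leftField 0 p = 0 := by
  simp [leftField]

theorem leftField_neg (a : Idx r → ℝ) (p : Pt r) : leftField (-a) p = -leftField a p := by
  simp [leftField]

theorem leftField_sub (a b : Idx r → ℝ) (p : Pt r) :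
    leftField (a - b) p = leftField a p - leftField b p := by
  simp [leftField, sub_smul]

theorem leftField_sum {ι : Type*} (s : Finset ι) (a : ι → Idx r → ℝ) (p : Pt r) :
    leftField (∑ i ∈ s, a i) p = ∑ i ∈ s, leftField (a i) p := by
  simp only [leftField, Finset.sum_apply, Finset.sum_smul]
  exact Finset.sum_comm

theorem leftField_apply_iX (a : Idx r → ℝ) (p : Pt r) (i : Fin r) :
    leftField a p (iX i) = a (iX i) := by
  simpa [coframe] using coframe_leftField (iX i) a p

theorem leftField_apply_iZ (a : Idx r → ℝ) (p : Pt r) : leftField a p iZ = a iZ := by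
  simpa [coframe] using coframe_leftField iZ a p

theorem leftField_apply_iY (a : Idx r → ℝ) (p : Pt r) (i : Fin r) :
    leftField a p (iY i) = a (iY i) + p (iX i) * a iZ := by
  have h := coframe_leftField (iY i) a p
  simp only [coframe, leftField_apply_iZ] at h
  linarith

/-- The Lie bracket of left-invariant fields, in components. -/
def bracket (a b : Idx r → ℝ) : Idx r → ℝ
  | Sum.inl _ => 0
  | Sum.inr (Sum.inl i) => a (iX i) * b iZ - a iZ * b (iX i)
  | Sum.inr (Sum.inr _) => 0

theorem hasFDerivAt_leftField (a : Idx r → ℝ) (p : Pt r) :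
    ∃ L : Pt r →L[ℝ] Pt r, HasFDerivAt (leftField a) L p ∧
      ∀ v, L v = fun
        | Sum.inl _ => 0
        | Sum.inr (Sum.inl i) => v (iX i) * a iZ
        | Sum.inr (Sum.inr _) => 0 := by
  refine ⟨ContinuousLinearMap.pi fun
    | Sum.inl _ => 0
    | Sum.inr (Sum.inl i) => (a iZ) • ContinuousLinearMap.proj (iX i)
    | Sum.inr (Sum.inr _) => 0, hasFDerivAt_pi.2 fun l => ?_, fun v => ?_⟩
  · rcases l with i | i | u
    · simp only [leftField_apply_iX]
      exact hasFDerivAt_const _ _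
    · simp only [leftField_apply_iY]
      exact ((hasFDerivAt_apply (𝕜 := ℝ) (iX i) p).mul_const (a iZ)).const_add _
    · simp only [show ∀ q, leftField a q (Sum.inr (Sum.inr u)) = a iZ from leftField_apply_iZ a]
      exact hasFDerivAt_const _ _
  · funext l
    rcases l with i | i | u <;> simp [mul_comm]

theorem lieBracket_leftField (a b : Idx r → ℝ) (p : Pt r) :
    VectorField.lieBracket ℝ (leftField a) (leftField b) p = leftField (bracket a b) p := by
  obtain ⟨L, hL, hLv⟩ := hasFDerivAt_leftField a p
  obtain ⟨M, hM, hMv⟩ := hasFDerivAt_leftField b p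
  rw [VectorField.lieBracket, hL.fderiv, hM.fderiv, hLv, hMv]
  funext l
  rcases l with i | i | u
  · simp [leftField_apply_iX, bracket]
  · simp [leftField_apply_iX, leftField_apply_iY, bracket]
    ring
  · have h := leftField_apply_iZ (bracket a b) p
    simpa [bracket] using h.symm

/-- The vector `e_Z`. -/
noncomputable def eZ : Idx r → ℝ := Pi.single iZ 1

/-- Exchange of the components along `X_i` and `X_{r+i}`, and projection off `Z`. -/
def swapXY (a : Idx r → ℝ) : Idx r → ℝ
  | Sum.inl i => a (iY i)
  | Sum.inr (Sum.inl i) => a (iX i)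
  | Sum.inr (Sum.inr _) => 0

/-- The endomorphism `X_i ↦ -X_{r+i}`, `X_{r+i} ↦ X_i`, `Z ↦ 0`. -/
def rot : Matrix (Idx r) (Idx r) ℝ
  | Sum.inl i, Sum.inr (Sum.inl j) => if i = j then 1 else 0
  | Sum.inr (Sum.inl i), Sum.inl j => if i = j then -1 else 0
  | _, _ => 0

/-- The endomorphism `u ↦ ∇_a u` of left-invariant fields. -/
noncomputable def conn (a : Idx r → ℝ) : Matrix (Idx r) (Idx r) ℝ :=
  (1 / 2 : ℝ) • (Matrix.vecMulVec (swapXY a) eZ - Matrix.vecMulVec eZ (swapXY a) + a iZ • rot)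

theorem rot_mulVec_iX (b : Idx r → ℝ) (i : Fin r) : (rot *ᵥ b) (iX i) = b (iY i) := by
  simp [Matrix.mulVec, dotProduct, rot, Fintype.sum_sum_type]

theorem rot_mulVec_iY (b : Idx r → ℝ) (i : Fin r) : (rot *ᵥ b) (iY i) = -b (iX i) := by
  simp [Matrix.mulVec, dotProduct, rot, Fintype.sum_sum_type]

theorem rot_mulVec_iZ (b : Idx r → ℝ) : (rot *ᵥ b) iZ = 0 := by
  simp [Matrix.mulVec, dotProduct, rot]

theorem rot_transpose : (rot : Matrix (Idx r) (Idx r) ℝ)ᵀ = -rot := by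
  ext k l
  rcases k with i | i | u <;> rcases l with j | j | v <;> simp [rot, eq_comm] <;>
    split_ifs <;> simp

theorem rot_mulVec_eZ : (rot : Matrix (Idx r) (Idx r) ℝ) *ᵥ eZ = 0 := by
  funext k
  rcases k with i | i | u
  · rw [rot_mulVec_iX]; simp [eZ]
  · rw [rot_mulVec_iY]; simp [eZ]
  · exact rot_mulVec_iZ _

theorem conn_transpose (a : Idx r → ℝ) : (conn a)ᵀ = -conn a := by
  simp only [conn, Matrix.transpose_smul, Matrix.transpose_add, Matrix.transpose_sub,
    Matrix.transpose_vecMulVec, rot_transpose]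
  module

theorem eZ_dotProduct (b : Idx r → ℝ) : eZ ⬝ᵥ b = b iZ := by simp [eZ]

theorem dotProduct_eZ (b : Idx r → ℝ) : b ⬝ᵥ eZ = b iZ := by simp [eZ]

theorem conn_mulVec (a b : Idx r → ℝ) :
    conn a *ᵥ b = (1 / 2 : ℝ) • (b iZ • swapXY a - (swapXY a ⬝ᵥ b) • eZ + a iZ • (rot *ᵥ b)) := by
  simp [conn, Matrix.smul_mulVec, Matrix.add_mulVec, Matrix.sub_mulVec, Matrix.vecMulVec_mulVec,
    eZ_dotProduct]

/-- Inner products of left-invariant fields are constant, so only the three bracket terms of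
Koszul's expression survive. -/
theorem koszul_leftField (a b c : Idx r → ℝ) (p : Pt r) :
    koszul (leftField a) (leftField b) (leftField c) p = (conn a *ᵥ b) ⬝ᵥ c := by
  simp only [koszul, metric_leftField, lieBracket_leftField, conn_mulVec]
  simp only [smul_dotProduct, add_dotProduct, sub_dotProduct, eZ_dotProduct, smul_eq_mul,
    fderiv_fun_const, Pi.zero_apply, zero_apply]
  have e1 := rot_mulVec_iX b
  have e2 := rot_mulVec_iY b
  have e3 := rot_mulVec_iZ b
  simp only [iX, iY, iZ] at e1 e2 e3 ⊢
  simp only [dotProduct, bracket, swapXY, Fintype.sum_sum_type, e1, e2, e3, iX, iY, iZ,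
    Finset.univ_unique, Finset.sum_singleton, PUnit.default_eq_unit]
  generalize a (Sum.inr (Sum.inr PUnit.unit)) = az
  generalize b (Sum.inr (Sum.inr PUnit.unit)) = bz
  generalize c (Sum.inr (Sum.inr PUnit.unit)) = cz
  simp only [add_mul, sub_mul, neg_mul, mul_neg, mul_add, mul_sub, Finset.mul_sum, Finset.sum_mul,
    zero_mul, Finset.sum_const_zero, Finset.sum_sub_distrib, Finset.sum_neg_distrib]
  simp only [mul_comm, mul_left_comm]
  ring_nf

theorem nabla_leftField (a b : Idx r → ℝ) :
    nabla (leftField a) (leftField b) = leftField (conn a *ᵥ b) := by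
  funext p
  have h : ∀ k, koszul (leftField a) (leftField b) (frame k) p = (conn a *ᵥ b) k := by
    intro k
    rw [frame_eq_leftField, koszul_leftField, dotProduct_single, mul_one]
  simp only [nabla, h, leftField]

theorem conn_add (a b : Idx r → ℝ) : conn (a + b) = conn a + conn b := by
  have h : swapXY (a + b) = swapXY a + swapXY b := by
    funext k; rcases k with i | i | u <;> simp [swapXY]
  simp only [conn, h, Matrix.add_vecMulVec, Matrix.vecMulVec_add, Pi.add_apply]
  module

theorem conn_smul (c : ℝ) (a : Idx r → ℝ) : conn (c • a) = c • conn a := by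
  have h : swapXY (c • a) = c • swapXY a := by
    funext k; rcases k with i | i | u <;> simp [swapXY]
  simp only [conn, h, Matrix.smul_vecMulVec, Matrix.vecMulVec_smul, Pi.smul_apply, smul_eq_mul]
  module

theorem conn_eq_sum (a : Idx r → ℝ) (l k : Idx r) :
    conn a l k = ∑ i, a i * conn (Pi.single i 1) l k := by
  let L : (Idx r → ℝ) →ₗ[ℝ] ℝ :=
    { toFun := fun a => conn a l k
      map_add' := fun a b => by simp [conn_add]
      map_smul' := fun c a => by simp [conn_smul] }
  have ha : a = ∑ i, a i • Pi.single i (1 : ℝ) := by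
    funext l
    rw [Finset.sum_apply, Finset.sum_eq_single l] <;> simp +contextual [eq_comm]
  change L a = ∑ i, a i * L (Pi.single i 1)
  conv_lhs => rw [ha]
  simp only [map_sum, map_smul, smul_eq_mul]

theorem connMatrix_eq (p v : Pt r) : connMatrix p v = conn fun k => coframe k p v := by
  ext k j
  rw [conn_eq_sum]
  simp [connMatrix, frame_eq_leftField, nabla_leftField, metric_leftField]

/-! ### The intrinsic torsion of a left-invariant structure -/

/-- The frame fields are geodesic, which removes the term of d^*ξ containing ∇_{e_i} e_i. -/
theorem conn_single_mulVec_single (i : Idx r) :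
    conn (Pi.single i 1) *ᵥ Pi.single i 1 = 0 := by
  rw [conn_mulVec]
  have h1 : swapXY (Pi.single i (1 : ℝ)) ⬝ᵥ Pi.single i 1 = 0 := by
    rw [dotProduct_single, mul_one]
    rcases i with i | i | u <;> simp [swapXY]
  rw [h1]
  rcases i with i | i | u
  · simp
  · simp
  · have h2 : swapXY (Pi.single (Sum.inr (Sum.inr u)) (1 : ℝ)) = (0 : Idx r → ℝ) := by
      funext k; rcases k with i | i | u <;> simp [swapXY]
    have h3 := rot_mulVec_eZ (r := r)
    rw [eZ] at h3
    rw [h2, show (Sum.inr (Sum.inr u) : Idx r) = iZ from rfl, h3]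
    simp

/-- The intrinsic torsion `ξ_a` of a linear structure on the Lie algebra with `ζ = Z`. -/
noncomputable def torsion (A : Matrix (Idx r) (Idx r) ℝ) (a : Idx r → ℝ) :
    Matrix (Idx r) (Idx r) ℝ :=
  -vert A eZ (conn a * A - A * conn a) (conn a *ᵥ eZ)

theorem conn_zero : conn (0 : Idx r → ℝ) = 0 := by
  have h := conn_smul (0 : ℝ) (0 : Idx r → ℝ)
  simpa using h

theorem torsion_zero (A : Matrix (Idx r) (Idx r) ℝ) : torsion A 0 = 0 := by
  simp [torsion, conn_zero, vert]

theorem swapXY_eZ : swapXY (eZ : Idx r → ℝ) = 0 := by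
  funext k
  rcases k with i | i | u <;> simp [swapXY, eZ]

theorem eZ_apply_iZ : (eZ : Idx r → ℝ) iZ = 1 := by simp [eZ]

theorem conn_eZ : conn (eZ : Idx r → ℝ) = (1 / 2 : ℝ) • rot := by
  simp [conn, swapXY_eZ, eZ_apply_iZ]

/-- ∇_Z Z = 0 kills the terms of `vert` containing ∇ζ. The factor ¼ is the ½ of `vert` times the ½
of `conn eZ`. -/
theorem torsion_eZ (A : Matrix (Idx r) (Idx r) ℝ) :
    torsion A eZ = -((1 / 4 : ℝ) • (A * (rot * A - A * rot))) := by
  simp only [torsion, vert, conn_eZ, Matrix.smul_mulVec, rot_mulVec_eZ, smul_zero,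
    Matrix.vecMulVec_zero, Matrix.zero_vecMulVec, sub_zero, add_zero, Matrix.smul_mul,
    Matrix.mul_smul, ← smul_sub, smul_smul]
  norm_num

theorem vecMul_conn (a b : Idx r → ℝ) : b ᵥ* conn a = -(conn a *ᵥ b) := by
  rw [← Matrix.mulVec_transpose, conn_transpose, Matrix.neg_mulVec]

theorem conn_mulVec_eZ (a : Idx r → ℝ) : conn a *ᵥ eZ = (1 / 2 : ℝ) • swapXY a := by
  rw [conn_mulVec, rot_mulVec_eZ, dotProduct_eZ, eZ_apply_iZ]
  simp [swapXY]

/-! ### Torsion of a linear structure with `ζ = Z` -/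

section Linear

variable {A : Matrix (Idx r) (Idx r) ℝ}

theorem conn_of_apply_iZ_eq_zero {a : Idx r → ℝ} (ha : a iZ = 0) :
    conn a = (1 / 2 : ℝ) • (Matrix.vecMulVec (swapXY a) eZ - Matrix.vecMulVec eZ (swapXY a)) := by
  simp [conn, ha]

theorem conn_commutator_of_apply_iZ_eq_zero (h : IsLinearACM A eZ) {a : Idx r → ℝ}
    (ha : a iZ = 0) : conn a * A - A * conn a = (1 / 2 : ℝ) •
      (Matrix.vecMulVec eZ (A *ᵥ swapXY a) - Matrix.vecMulVec (A *ᵥ swapXY a) eZ) := by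
  have hv : ∀ b : Idx r → ℝ, b ᵥ* A = -(A *ᵥ b) := fun b => by
    rw [← Matrix.mulVec_transpose, h.skew, Matrix.neg_mulVec]
  simp only [conn_of_apply_iZ_eq_zero ha, Matrix.smul_mul, Matrix.mul_smul, sub_mul, mul_sub,
    Matrix.vecMulVec_mul, Matrix.mul_vecMulVec, hv, h.mulVec_eq_zero, Matrix.zero_vecMulVec,
    neg_zero, Matrix.vecMulVec_zero, Matrix.vecMulVec_neg]
  module

theorem mulVec_mulVec_swapXY (h : IsLinearACM A eZ) (a : Idx r → ℝ) :
    A *ᵥ (A *ᵥ swapXY a) = -swapXY a := by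
  rw [Matrix.mulVec_mulVec, h.sq, Matrix.add_mulVec, Matrix.vecMulVec_mulVec, eZ_dotProduct]
  simp [swapXY, Matrix.neg_mulVec]

/-- For horizontal `a`, `conn a` maps Z into its complement and the complement into the line of Z.
It is therefore orthogonal to the stabiliser algebra, which kills Z, and coincides with its own
u(r)^⊥ part. -/
theorem torsion_of_apply_iZ_eq_zero (h : IsLinearACM A eZ) {a : Idx r → ℝ} (ha : a iZ = 0) :
    torsion A a = -conn a := by
  rw [torsion, conn_commutator_of_apply_iZ_eq_zero h ha, vert, conn_mulVec_eZ,
    conn_of_apply_iZ_eq_zero ha]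
  simp only [Matrix.mul_smul, mul_sub, Matrix.mul_vecMulVec, mulVec_mulVec_swapXY h,
    h.mulVec_eq_zero, Matrix.zero_vecMulVec, Matrix.neg_vecMulVec, Matrix.smul_vecMulVec,
    Matrix.vecMulVec_smul]
  module

/-- In a horizontal direction the torsion is minus the connection matrix, so the two commute; only
the direction Z contributes. -/
theorem sum_conn_torsion_commutator (h : IsLinearACM A eZ) :
    ∑ i, (conn (Pi.single i 1) * torsion A (Pi.single i 1)
      - torsion A (Pi.single i 1) * conn (Pi.single i 1))
      = -((1 / 8 : ℝ) • (rot * (A * (rot * A - A * rot)) - A * (rot * A - A * rot) * rot)) := by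
  rw [Finset.sum_eq_single iZ]
  · rw [← eZ, torsion_eZ, conn_eZ]
    simp only [Matrix.smul_mul, Matrix.mul_smul, mul_neg, neg_mul]
    module
  · intro i _ hi
    rw [torsion_of_apply_iZ_eq_zero h (by simp [hi.symm])]
    simp
  · simp

end Linear

/-! ### Left-invariant structures as constant matrices -/

namespace AlmostContactMetric

variable {S : AlmostContactMetric r}

/-- The components of `φ` at the identity. -/
noncomputable def phiMatrix (S : AlmostContactMetric r) : Matrix (Idx r) (Idx r) ℝ :=
  Matrix.of fun l k => S.comp l k 0

theorem IsLeftInvariant.comp_eq (h : S.IsLeftInvariant) (l k : Idx r) (p : Pt r) :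
    S.comp l k p = S.phiMatrix l k := by
  have h0 : mul p 0 = p := by
    funext k
    rcases k with i | i | u <;> simp [mul]
  -- The origin is the identity of the group, so left translation by `p` carries the components
  -- there to those at `p`.
  have h1 := h.1 p 0 (frame k 0)
  rw [dL_frame, h0] at h1
  have h2 : dL p 0 (S.φ 0 (frame k 0)) = ∑ m, S.comp m k 0 • frame m p := by
    conv_lhs => rw [← sum_coframe_smul_frame 0 (S.φ 0 (frame k 0))]
    simp only [map_sum, map_smul, dL_frame, h0]
    rfl
  rw [comp, h1, h2]
  exact coframe_leftField l _ p

theorem IsLeftInvariant.phi_leftField (h : S.IsLeftInvariant) (b : Idx r → ℝ) (p : Pt r) :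
    S.φ p (leftField b p) = leftField (S.phiMatrix *ᵥ b) p := by
  have h1 : ∀ k, S.φ p (frame k p) = leftField (fun l => S.phiMatrix l k) p := by
    intro k
    rw [← leftField_coframe p (S.φ p (frame k p))]
    congr 1
    funext l
    exact h.comp_eq l k p
  have h2 : S.phiMatrix *ᵥ b = ∑ k, b k • fun l => S.phiMatrix l k := by
    funext l
    simp [Matrix.mulVec, dotProduct, mul_comm]
  rw [h2, leftField_sum]
  simp only [leftField_smul, ← h1]
  simp only [leftField, map_sum, map_smul]

theorem zeta_eq (hζ : ∀ p, S.ζ p = frame iZ p) : S.ζ = leftField eZ := by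
  funext p
  rw [hζ p, frame_eq_leftField]
  rfl

theorem compZeta_eq (hζ : ∀ p, S.ζ p = frame iZ p) (p : Pt r) : S.compZeta p = eZ := by
  funext k
  rw [compZeta, zeta_eq hζ, coframe_leftField]

theorem isLinearACM_phiMatrix (hζ : ∀ p, S.ζ p = frame iZ p) : IsLinearACM S.phiMatrix eZ := by
  have h := S.isLinearACM 0
  rwa [compZeta_eq hζ] at h

/-- On left-invariant arguments η is constant, so (∇_a η) b = -η(∇_a b) = ⟨∇_a ζ, b⟩. The defining
formula of ξ then matches minus the formula `vert` applied to (∇_a φ, ∇_a ζ). -/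
theorem xi_leftField (hinv : S.IsLeftInvariant) (hζ : ∀ p, S.ζ p = frame iZ p)
    (a b : Idx r → ℝ) :
    S.xi (leftField a) (leftField b) = leftField (torsion S.phiMatrix a *ᵥ b) := by
  have e1 : (fun q => S.φ q (leftField b q)) = leftField (S.phiMatrix *ᵥ b) :=
    funext fun q => hinv.phi_leftField b q
  have e2 : S.η (leftField b) = fun _ => b iZ := by
    funext q
    rw [η, zeta_eq hζ, metric_leftField, eZ_dotProduct]
  have e3 : ∀ p, S.η (leftField (conn a *ᵥ b)) p = -((conn a *ᵥ eZ) ⬝ᵥ b) := by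
    intro p
    rw [η, zeta_eq hζ, metric_leftField, Matrix.dotProduct_mulVec, vecMul_conn,
      neg_dotProduct]
  funext p
  rw [xi, nablaPhi, nablaEta, zeta_eq hζ, e1, e2]
  simp only [nabla_leftField, e3, hinv.phi_leftField, fderiv_fun_const, Pi.zero_apply, zero_apply,
    ← leftField_sub, ← leftField_smul, ← leftField_neg, ← leftField_add]
  congr 1
  simp only [torsion, vert, Matrix.neg_mulVec, Matrix.add_mulVec, Matrix.sub_mulVec,
    Matrix.smul_mulVec, Matrix.vecMulVec_mulVec, ← Matrix.mulVec_mulVec, eZ_dotProduct,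
    Matrix.mulVec_sub, op_smul_eq_smul]
  module

/-- On left-invariant fields d^*ξ acts by a constant matrix, a nonzero multiple of the commutator of
`rot` with `A * (rot * A - A * rot)`, where `A` is `phiMatrix`. -/
theorem isHarmonic_iff (hinv : S.IsLeftInvariant) (hζ : ∀ p, S.ζ p = frame iZ p) :
    S.IsHarmonic ↔ rot * (S.phiMatrix * (rot * S.phiMatrix - S.phiMatrix * rot))
      = S.phiMatrix * (rot * S.phiMatrix - S.phiMatrix * rot) * rot := by
  have hd : ∀ k p, S.dstarXi (frame k) p = leftField (-((∑ i, (conn (Pi.single i 1)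
      * torsion S.phiMatrix (Pi.single i 1) - torsion S.phiMatrix (Pi.single i 1)
      * conn (Pi.single i 1))) *ᵥ Pi.single k 1)) p := by
    intro k p
    have e0 : S.xi (leftField 0) (leftField (Pi.single k 1)) p = 0 := by
      rw [xi_leftField hinv hζ, torsion_zero, Matrix.zero_mulVec, leftField_zero]
    rw [dstarXi, leftField_neg, Matrix.sum_mulVec, leftField_sum]
    refine congrArg _ (Finset.sum_congr rfl fun i _ => ?_)
    rw [frame_eq_leftField i, frame_eq_leftField k]
    simp only [nabla_leftField, xi_leftField hinv hζ, conn_single_mulVec_single, torsion_zero,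
      Matrix.zero_mulVec, leftField_zero, sub_zero, Matrix.sub_mulVec, leftField_sub,
      ← Matrix.mulVec_mulVec]
  have key : S.IsHarmonic ↔ ∑ i, (conn (Pi.single i 1)
      * torsion S.phiMatrix (Pi.single i 1) - torsion S.phiMatrix (Pi.single i 1)
      * conn (Pi.single i 1)) = 0 := by
    constructor
    · intro h
      ext l k
      have h1 := h k 0
      rw [hd, leftField_neg, neg_eq_zero] at h1
      have h2 := coframe_leftField l ((∑ i, (conn (Pi.single i 1)
        * torsion S.phiMatrix (Pi.single i 1) - torsion S.phiMatrix (Pi.single i 1)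
        * conn (Pi.single i 1))) *ᵥ Pi.single k 1) 0
      have h3 : leftField (0 : Idx r → ℝ) 0 = 0 := leftField_zero 0
      rw [h1.trans h3.symm, coframe_leftField, Matrix.mulVec_single_one] at h2
      exact h2.symm
    · intro h k p
      rw [hd, h, Matrix.zero_mulVec, neg_zero, leftField_zero]
  rw [key, sum_conn_torsion_commutator (isLinearACM_phiMatrix hζ), neg_eq_zero,
    smul_eq_zero, sub_eq_zero]
  norm_num

theorem metric_xi_frame_iZ (hinv : S.IsLeftInvariant) (hζ : ∀ p, S.ζ p = frame iZ p)
    (k l : Idx r) (p : Pt r) :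
    metric p (S.xi (frame iZ) (frame k) p) (frame l p)
      = -(1 / 4 * (S.phiMatrix * (rot * S.phiMatrix - S.phiMatrix * rot) :
        Matrix (Idx r) (Idx r) ℝ) l k) := by
  rw [frame_eq_leftField iZ, frame_eq_leftField k, xi_leftField hinv hζ, metric_frame,
    coframe_leftField, ← eZ, torsion_eZ, Matrix.mulVec_single_one]
  simp

end AlmostContactMetric

/-- Square matrices indexed by the frame. -/
abbrev Mat (r : ℕ) := Matrix (Idx r) (Idx r) ℝ

/-! ### Commutation with the rotation, in components -/

theorem rot_mul_iX (N : Matrix (Idx r) (Idx r) ℝ) (i : Fin r) (k : Idx r) :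
    (rot * N : Mat r) (iX i) k = N (iY i) k := rot_mulVec_iX (fun m => N m k) i

theorem rot_mul_iY (N : Matrix (Idx r) (Idx r) ℝ) (i : Fin r) (k : Idx r) :
    (rot * N : Mat r) (iY i) k = -N (iX i) k := rot_mulVec_iY (fun m => N m k) i

theorem rot_mul_iZ (N : Matrix (Idx r) (Idx r) ℝ) (k : Idx r) :
    (rot * N : Mat r) iZ k = 0 := rot_mulVec_iZ (fun m => N m k)

theorem mul_rot_apply (N : Matrix (Idx r) (Idx r) ℝ) (k l : Idx r) :
    (N * rot : Mat r) k l = -(rot * Nᵀ : Mat r) l k := by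
  have h : (N * rot)ᵀ = -(rot * Nᵀ) := by
    rw [Matrix.transpose_mul, rot_transpose, neg_mul]
  exact congrFun (congrFun h l) k

theorem mul_rot_iX (N : Matrix (Idx r) (Idx r) ℝ) (k : Idx r) (j : Fin r) :
    (N * rot : Mat r) k (iX j) = -N k (iY j) := by
  rw [mul_rot_apply, rot_mul_iX]; rfl

theorem mul_rot_iY (N : Matrix (Idx r) (Idx r) ℝ) (k : Idx r) (j : Fin r) :
    (N * rot : Mat r) k (iY j) = N k (iX j) := by
  rw [mul_rot_apply, rot_mul_iY, neg_neg]; rfl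

theorem mul_rot_iZ (N : Matrix (Idx r) (Idx r) ℝ) (k : Idx r) :
    (N * rot : Mat r) k iZ = 0 := by
  rw [mul_rot_apply, rot_mul_iZ, neg_zero]

/-- `rot` is, up to sign, the standard complex structure on the horizontal space. Skewness of `M`
makes the four block equations collapse to two, and the entries along Z vanish on both sides. -/
theorem rot_mul_eq_mul_rot_iff {M : Matrix (Idx r) (Idx r) ℝ} (hM : Mᵀ = -M)
    (hZ : ∀ k, M k iZ = 0) : rot * M = M * rot ↔
      ∀ i j, M (iX j) (iX i) = M (iY j) (iY i) ∧ M (iY j) (iX i) = M (iY i) (iX j) := by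
  have hs : ∀ k l, M l k = -M k l := fun k l => congrFun (congrFun hM k) l
  constructor
  · intro h i j
    have h1 := congrFun (congrFun h (iX j)) (iY i)
    have h2 := congrFun (congrFun h (iX j)) (iX i)
    rw [rot_mul_iX, mul_rot_iY] at h1
    rw [rot_mul_iX, mul_rot_iX, ← hs] at h2
    exact ⟨h1.symm, h2⟩
  · intro h
    ext k l
    rcases k with i | i | u <;> rcases l with j | j | v
    · change (rot * M : Mat r) (iX i) (iX j) = (M * rot : Mat r) (iX i) (iX j)
      rw [rot_mul_iX, mul_rot_iX, ← hs]
      exact (h j i).2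
    · change (rot * M : Mat r) (iX i) (iY j) = (M * rot : Mat r) (iX i) (iY j)
      rw [rot_mul_iX, mul_rot_iY]
      exact (h j i).1.symm
    · change (rot * M : Mat r) (iX i) iZ = (M * rot : Mat r) (iX i) iZ
      rw [rot_mul_iX, mul_rot_iZ, hZ]
    · change (rot * M : Mat r) (iY i) (iX j) = (M * rot : Mat r) (iY i) (iX j)
      rw [rot_mul_iY, mul_rot_iX, (h j i).1]
    · change (rot * M : Mat r) (iY i) (iY j) = (M * rot : Mat r) (iY i) (iY j)
      rw [rot_mul_iY, mul_rot_iY, ← hs]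
      exact (h i j).2
    · change (rot * M : Mat r) (iY i) iZ = (M * rot : Mat r) (iY i) iZ
      rw [rot_mul_iY, mul_rot_iZ, hZ, neg_zero]
    · change (rot * M : Mat r) iZ (iX j) = (M * rot : Mat r) iZ (iX j)
      rw [rot_mul_iZ, mul_rot_iX, ← hs, hZ]
    · change (rot * M : Mat r) iZ (iY j) = (M * rot : Mat r) iZ (iY j)
      rw [rot_mul_iZ, mul_rot_iY, hs, hZ, neg_zero]
    · change (rot * M : Mat r) iZ iZ = (M * rot : Mat r) iZ iZ
      rw [rot_mul_iZ, mul_rot_iZ]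

theorem eZ_vecMul_rot : (eZ : Idx r → ℝ) ᵥ* rot = 0 := by
  rw [← Matrix.mulVec_transpose, rot_transpose, Matrix.neg_mulVec, rot_mulVec_eZ, neg_zero]

/-! ### The harmonicity equation in the entries of φ -/

section Linear

variable {A : Matrix (Idx r) (Idx r) ℝ}

theorem mul_rot_commutator (h : IsLinearACM A eZ) :
    A * (rot * A - A * rot) = A * rot * A + rot := by
  rw [mul_sub, ← mul_assoc, ← mul_assoc, h.sq, add_mul, Matrix.vecMulVec_mul, eZ_vecMul_rot]
  simp

theorem mul_rot_commutator_transpose (h : IsLinearACM A eZ) :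
    (A * (rot * A - A * rot))ᵀ = -(A * (rot * A - A * rot)) := by
  rw [mul_rot_commutator h]
  simp only [Matrix.transpose_add, Matrix.transpose_mul, h.skew, rot_transpose, neg_mul, mul_neg,
    neg_neg, mul_assoc]
  abel

theorem apply_iZ_right (h : IsLinearACM A eZ) (k : Idx r) : A k iZ = 0 := by
  have h1 := congrFun h.mulVec_eq_zero k
  rwa [eZ, Matrix.mulVec_single_one] at h1

theorem apply_swap (h : IsLinearACM A eZ) (k l : Idx r) : A l k = -A k l :=
  congrFun (congrFun h.skew k) l

theorem apply_iZ_left (h : IsLinearACM A eZ) (k : Idx r) : A iZ k = 0 := by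
  rw [apply_swap h, apply_iZ_right h, neg_zero]

theorem mul_rot_mul_apply (h : IsLinearACM A eZ) (k l : Idx r) :
    (A * rot * A : Mat r) k l
      = ∑ m, (-(A (iX m) k * A (iY m) l) + A (iY m) k * A (iX m) l) := by
  rw [Matrix.mul_apply]
  simp only [Fintype.sum_sum_type, mul_rot_iX, mul_rot_iY]
  rw [← add_assoc, ← Finset.sum_add_distrib]
  simp only [show ∀ u : Unit, A (Sum.inr (Sum.inr u)) l = 0 from fun _ => apply_iZ_left h l,
    mul_zero, Finset.sum_const_zero, add_zero]
  refine Finset.sum_congr rfl fun m _ => ?_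
  rw [apply_swap h (iX m) k, apply_swap h (iY m) k]
  ring

theorem rot_mul_rot_commutator_iff (h : IsLinearACM A eZ) :
    rot * (A * (rot * A - A * rot)) = A * (rot * A - A * rot) * rot ↔
      ∀ i j : Fin r,
        (A * (rot * A - A * rot) : Mat r) (iX j) (iX i) = (A * (rot * A - A * rot) : Mat r) (iY j) (iY i) ∧
        (A * (rot * A - A * rot) : Mat r) (iY j) (iX i) = (A * (rot * A - A * rot) : Mat r) (iY i) (iX j) := by
  refine rot_mul_eq_mul_rot_iff (mul_rot_commutator_transpose h) fun k => ?_
  rw [mul_rot_commutator h, Matrix.add_apply, mul_rot_mul_apply h]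
  rcases k with i | i | u <;> simp [apply_iZ_right h, rot]

/-- Distinct columns of `A` are orthogonal, by the compatibility with the metric; their Z-entries
vanish. -/
theorem sum_mul_offdiag (h : IsLinearACM A eZ) (i j : Fin r) :
    ∑ k : Fin r, (A (iX k) (iX i) * A (iX k) (iY j) + A (iY k) (iX i) * A (iY k) (iY j)) = 0 := by
  have h1 := congrFun (congrFun h.compat (iX i)) (iY j)
  rw [Matrix.mul_apply] at h1
  simp only [Fintype.sum_sum_type, Matrix.transpose_apply] at h1
  simp [apply_iZ_left h, Matrix.vecMulVec_apply, eZ, ← Finset.sum_add_distrib] at h1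
  exact h1

/-- The second sum is the second equation for `A * rot * A` written out. The first sum is the first
equation plus two column inner products, which vanish by `sum_mul_offdiag`. -/
theorem mul_rot_commutator_components_iff (h : IsLinearACM A eZ) (i j : Fin r) :
    ((A * (rot * A - A * rot) : Mat r) (iX j) (iX i) = (A * (rot * A - A * rot) : Mat r) (iY j) (iY i) ∧
      (A * (rot * A - A * rot) : Mat r) (iY j) (iX i) = (A * (rot * A - A * rot) : Mat r) (iY i) (iX j)) ↔
    (∑ k : Fin r,
        ((A (iY k) (iX j) + A (iX k) (iY j)) * (A (iX k) (iX i) + A (iY k) (iY i))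
          + (A (iY k) (iY j) - A (iX k) (iX j)) * (A (iY k) (iX i) - A (iX k) (iY i))) = 0 ∧
      ∑ k : Fin r,
        (A (iX k) (iX i) * A (iY k) (iY j) - A (iY k) (iX i) * A (iX k) (iY j)
          + A (iY k) (iX j) * A (iX k) (iY i) - A (iX k) (iX j) * A (iY k) (iY i)) = 0) := by
  rw [mul_rot_commutator h]
  simp only [Matrix.add_apply, mul_rot_mul_apply h]
  have e1 := sum_mul_offdiag h i j
  have e2 := sum_mul_offdiag h j i
  -- The summand `rot` drops out: its entries vanish in the first equation and agree on both sides
  -- of the second.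
  have r1 : (rot : Matrix (Idx r) (Idx r) ℝ) (iX j) (iX i) = 0 := rfl
  have r2 : (rot : Matrix (Idx r) (Idx r) ℝ) (iY j) (iY i) = 0 := rfl
  have r3 : (rot : Matrix (Idx r) (Idx r) ℝ) (iY j) (iX i) = rot (iY i) (iX j) := by
    simp [rot, eq_comm]
  rw [r1, r2, r3, add_zero, add_zero, add_left_inj, ← sub_eq_zero,
    ← sub_eq_zero (a := Finset.sum _ fun m => -(A (iX m) (iY j) * _) + _)]
  rw [← Finset.sum_sub_distrib, ← Finset.sum_sub_distrib]
  refine and_congr ?_ ?_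
  · have e : ∑ k : Fin r,
        ((A (iY k) (iX j) + A (iX k) (iY j)) * (A (iX k) (iX i) + A (iY k) (iY i))
          + (A (iY k) (iY j) - A (iX k) (iX j)) * (A (iY k) (iX i) - A (iX k) (iY i)))
        = ∑ k : Fin r, (-(A (iX k) (iX j) * A (iY k) (iX i)) + A (iY k) (iX j) * A (iX k) (iX i)
          - (-(A (iX k) (iY j) * A (iY k) (iY i)) + A (iY k) (iY j) * A (iX k) (iY i)))
        + (∑ k : Fin r, (A (iX k) (iX i) * A (iX k) (iY j) + A (iY k) (iX i) * A (iY k) (iY j))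
        + ∑ k : Fin r, (A (iX k) (iX j) * A (iX k) (iY i) + A (iY k) (iX j) * A (iY k) (iY i))) := by
      rw [← Finset.sum_add_distrib, ← Finset.sum_add_distrib]
      refine Finset.sum_congr rfl fun k _ => ?_
      ring
    rw [e, e1, e2, add_zero, add_zero]
  · refine Eq.congr (Finset.sum_congr rfl fun k _ => ?_) rfl
    ring

end Linear

/-! ### Vectors tangent to the space of linear structures -/

/-- The inner product of `(1,1)`-tensors. -/
noncomputable def frob (M N : Mat r) : ℝ := ∑ k, ∑ l, M k l * N k l

theorem frob_eq_trace (M N : Mat r) : frob M N = (M * Nᵀ).trace := by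
  simp [frob, Matrix.trace, Matrix.mul_apply]

theorem frob_add_right (M N P : Mat r) : frob M (N + P) = frob M N + frob M P := by
  simp [frob_eq_trace, mul_add]

theorem frob_sub_right (M N P : Mat r) : frob M (N - P) = frob M N - frob M P := by
  simp [frob_eq_trace, mul_sub]

theorem frob_smul_right (c : ℝ) (M N : Mat r) : frob M (c • N) = c * frob M N := by
  simp [frob_eq_trace]

theorem frob_comm (M N : Mat r) : frob M N = frob N M := by
  simp only [frob, mul_comm]

theorem frob_smul_left (c : ℝ) (M N : Mat r) : frob (c • M) N = c * frob M N := by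
  simp [frob_eq_trace]

theorem frob_vecMulVec (M : Mat r) (u v : Idx r → ℝ) :
    frob M (Matrix.vecMulVec u v) = u ⬝ᵥ (M *ᵥ v) := by
  rw [frob_eq_trace, Matrix.transpose_vecMulVec, Matrix.mul_vecMulVec, Matrix.trace_vecMulVec,
    dotProduct_comm]

/-- `(A', w')` satisfies the linearised equations of `IsLinearACM` at `(A, w)`. -/
structure IsTangent (A : Mat r) (w : Idx r → ℝ) (A' : Mat r) (w' : Idx r → ℝ) : Prop where
  skew : A'ᵀ = -A'
  sq : A' * A + A * A' = Matrix.vecMulVec w' w + Matrix.vecMulVec w w'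
  unit : w ⬝ᵥ w' = 0

section

variable {A A' : Mat r} {w w' : Idx r → ℝ}

theorem vecMul_of_skew (h : A'ᵀ = -A') (b : Idx r → ℝ) : b ᵥ* A' = -(A' *ᵥ b) := by
  rw [← Matrix.mulVec_transpose, h, Matrix.neg_mulVec]

theorem IsTangent.mulVec_eq (h : IsLinearACM A w) (t : IsTangent A w A' w') :
    A' *ᵥ w = -(A *ᵥ w') := by
  have hv := isVerticalPart_vert h t.skew t.sq t.unit
  have h1 := congrArg (fun M => M *ᵥ w) hv.phi
  simp only [Matrix.sub_mulVec, ← Matrix.mulVec_mulVec, h.mulVec_eq_zero, hv.zeta,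
    Matrix.mulVec_zero, zero_sub] at h1
  exact h1.symm

/-- On the block orthogonal to w, `vert` is ½ A A' with `A` an isometry, whence ¼. The entries
mixing w with its complement contribute 2|w'|² both to `vert` and to A', since A'w = -Aw'; hence 2 =
¼ · 2 + 3/2. -/
theorem IsTangent.frob_vert (h : IsLinearACM A w) (t : IsTangent A w A' w') :
    frob (vert A w A' w') (vert A w A' w') = 1 / 4 * frob A' A' + 3 / 2 * (w' ⬝ᵥ w') := by
  have e1 := t.mulVec_eq h
  have e2 : w ᵥ* A' = A *ᵥ w' := by rw [vecMul_of_skew t.skew, e1, neg_neg]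
  have e3 : A *ᵥ (A *ᵥ w') = -w' := by
    rw [Matrix.mulVec_mulVec, h.sq, Matrix.add_mulVec, Matrix.vecMulVec_mulVec, t.unit]
    simp [Matrix.neg_mulVec]
  have e4 : (A *ᵥ w') ᵥ* A = w' := by rw [vecMul_of_skew h.skew, e3, neg_neg]
  have e5 : (A *ᵥ w') ⬝ᵥ (A *ᵥ w') = w' ⬝ᵥ w' := by rw [Matrix.dotProduct_mulVec, e4]
  have e6 : w' ⬝ᵥ w = 0 := by rw [dotProduct_comm, t.unit]
  have e7 : (A * A' * (A' * A)).trace = frob A' A' - w' ⬝ᵥ w' := by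
    rw [show A * A' * (A' * A) = A * (A' * A' * A) by simp only [mul_assoc],
      Matrix.trace_mul_comm, mul_assoc, h.sq, mul_add, Matrix.trace_add, Matrix.mul_vecMulVec,
      Matrix.trace_vecMulVec, ← Matrix.mulVec_mulVec, e1, dotProduct_comm,
      Matrix.dotProduct_mulVec, e2, dotProduct_neg, e5, frob_eq_trace, t.skew]
    simp [sub_eq_add_neg]
  have e8 : ∀ b : Idx r → ℝ, (A *ᵥ b) ⬝ᵥ w = 0 := fun b => by
    rw [dotProduct_comm, Matrix.dotProduct_mulVec, h.vecMul_eq_zero, zero_dotProduct]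
  have hT : (vert A w A' w')ᵀ = (1 / 2 : ℝ) • (A' * A) - Matrix.vecMulVec w' w
      + (1 / 2 : ℝ) • Matrix.vecMulVec w w' := by
    simp only [vert, Matrix.transpose_add, Matrix.transpose_sub, Matrix.transpose_smul,
      Matrix.transpose_mul, Matrix.transpose_vecMulVec, h.skew, t.skew, neg_mul_neg]
  rw [frob_eq_trace, hT, vert]
  simp only [add_mul, sub_mul, mul_add, mul_sub, Matrix.smul_mul, Matrix.mul_smul,
    Matrix.trace_add, Matrix.trace_sub, Matrix.trace_smul, e7, Matrix.mul_vecMulVec,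
    Matrix.vecMulVec_mul, Matrix.trace_vecMulVec, Matrix.smul_mulVec, ← Matrix.mulVec_mulVec, ← Matrix.vecMul_vecMul,
    e1, e2, e4, e8, Matrix.vecMulVec_mulVec, Matrix.mulVec_neg, e3,
    neg_neg, t.unit, e6, h.unit, smul_eq_mul, smul_dotProduct,
    op_smul_eq_smul]
  have e9 : w ⬝ᵥ (w' ᵥ* A') ᵥ* A = 0 := by
    rw [dotProduct_comm, ← Matrix.dotProduct_mulVec, h.mulVec_eq_zero, dotProduct_zero]
  rw [e9]
  ring

theorem IsTangent.add {A'' : Mat r} {w'' : Idx r → ℝ} (t : IsTangent A w A' w')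
    (t' : IsTangent A w A'' w'') : IsTangent A w (A' + A'') (w' + w'') where
  skew := by rw [Matrix.transpose_add, t.skew, t'.skew]; abel
  sq := by
    rw [add_mul, mul_add, Matrix.add_vecMulVec, Matrix.vecMulVec_add,
      add_add_add_comm, t.sq, t'.sq]
    abel
  unit := by rw [dotProduct_add, t.unit, t'.unit, add_zero]

/-- This is the infinitesimal action of so(2r+1), which preserves the space of linear structures. -/
theorem isTangent_commutator (h : IsLinearACM A w) {b : Mat r} (hb : bᵀ = -b) :
    IsTangent A w (b * A - A * b) (b *ᵥ w) where
  skew := by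
    rw [Matrix.transpose_sub, Matrix.transpose_mul, Matrix.transpose_mul, hb, h.skew]
    simp
  sq := by
    have e : (b * A - A * b) * A + A * (b * A - A * b) = b * (A * A) - (A * A) * b := by
      noncomm_ring
    rw [e, h.sq, mul_add, add_mul, Matrix.mul_vecMulVec, Matrix.vecMulVec_mul, vecMul_of_skew hb,
      Matrix.vecMulVec_neg]
    noncomm_ring
  unit := by
    have h1 : w ⬝ᵥ b *ᵥ w = -(w ⬝ᵥ b *ᵥ w) := by
      conv_lhs => rw [Matrix.dotProduct_mulVec, vecMul_of_skew hb, neg_dotProduct, dotProduct_comm]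
    linarith

theorem commutator_transpose (h : A'ᵀ = -A') {b : Mat r} (hb : bᵀ = -b) :
    (b * A' - A' * b)ᵀ = -(b * A' - A' * b) := by
  rw [Matrix.transpose_sub, Matrix.transpose_mul, Matrix.transpose_mul, hb, h]
  simp

theorem IsTangent.trace_mul (t : IsTangent A w A' w') : (A' * A).trace = 0 := by
  have h := congrArg Matrix.trace t.sq
  rw [Matrix.trace_add, Matrix.trace_mul_comm A A', Matrix.trace_add, Matrix.trace_vecMulVec,
    Matrix.trace_vecMulVec, dotProduct_comm w' w, t.unit] at h
  linarith

end

/-! ### The first variation, pointwise -/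

section

variable {A A' : Mat r} {w' : Idx r → ℝ}

theorem eZ_dotProduct_conn (a b : Idx r → ℝ) :
    eZ ⬝ᵥ (conn a *ᵥ b) = -((1 / 2 : ℝ) * (swapXY a ⬝ᵥ b)) := by
  rw [Matrix.dotProduct_mulVec, vecMul_conn, conn_mulVec_eZ, neg_dotProduct, smul_dotProduct,
    smul_eq_mul]

theorem dotProduct_mulVec_self (h : A'ᵀ = -A') (s : Idx r → ℝ) : s ⬝ᵥ (A' *ᵥ s) = 0 := by
  have h1 : s ⬝ᵥ A' *ᵥ s = -(s ⬝ᵥ A' *ᵥ s) := by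
    conv_lhs => rw [Matrix.dotProduct_mulVec, vecMul_of_skew h, neg_dotProduct, dotProduct_comm]
  linarith

theorem frob_conn_commutator (h : IsLinearACM A eZ) {a : Idx r → ℝ} (ha : a iZ = 0) {M : Mat r}
    (hM : Mᵀ = -M) : frob (conn a * A - A * conn a) M = eZ ⬝ᵥ (M *ᵥ (A *ᵥ swapXY a)) := by
  rw [conn_commutator_of_apply_iZ_eq_zero h ha, frob_smul_left, frob_comm, frob_sub_right,
    frob_vecMulVec, frob_vecMulVec, Matrix.dotProduct_mulVec (A *ᵥ swapXY a), vecMul_of_skew hM,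
    neg_dotProduct, dotProduct_comm (M *ᵥ _) eZ]
  ring

/-- Writing s for `swapXY a`, `conn a` kills A s, because A s is horizontal and orthogonal to s. One
of the two terms of the commutator thus disappears. -/
theorem frob_conn_conn_commutator (h : IsLinearACM A eZ) (t : IsTangent A eZ A' w')
    {a : Idx r → ℝ} (ha : a iZ = 0) :
    frob (conn a * A - A * conn a) (conn a * A' - A' * conn a)
      = -((1 / 2 : ℝ) * (swapXY a ⬝ᵥ ((A' * A) *ᵥ swapXY a))) := by
  have h0 : (A *ᵥ swapXY a) iZ = 0 := by
    rw [← eZ_dotProduct (A *ᵥ swapXY a), Matrix.dotProduct_mulVec, h.vecMul_eq_zero, zero_dotProduct]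
  have h1 : conn a *ᵥ (A *ᵥ swapXY a) = 0 := by
    rw [conn_mulVec, h0, dotProduct_mulVec_self h.skew, ha]
    simp
  rw [frob_conn_commutator h ha (commutator_transpose t.skew (conn_transpose a)),
    Matrix.sub_mulVec, ← Matrix.mulVec_mulVec, ← Matrix.mulVec_mulVec, h1, Matrix.mulVec_zero,
    sub_zero, eZ_dotProduct_conn, Matrix.mulVec_mulVec]

theorem conn_eZ_dotProduct_conn (t : IsTangent A eZ A' w') {a : Idx r → ℝ} (ha : a iZ = 0) :
    (conn a *ᵥ eZ) ⬝ᵥ (conn a *ᵥ w') = 0 := by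
  have h0 : w' iZ = 0 := by rw [← eZ_dotProduct w', t.unit]
  rw [conn_mulVec_eZ, conn_mulVec a w', h0, ha]
  simp [dotProduct_eZ, swapXY]

/-- With B = [rot, A] and C = [rot, B], skew-adjointness of the bracket turns the pairing into tr(C
A'). The hypothesis makes C commute with `A`, whereas A' anticommutes with `A` modulo terms in Z,
which C kills. -/
theorem frob_rot_rot_commutator (h : IsLinearACM A eZ) (t : IsTangent A eZ A' w')
    (hc : rot * (A * (rot * A - A * rot)) = A * (rot * A - A * rot) * rot) :
    frob (rot * A - A * rot) (rot * A' - A' * rot) = 0 := by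
  set B : Mat r := rot * A - A * rot with hB
  have hBs : Bᵀ = -B := commutator_transpose h.skew rot_transpose
  -- This sum is [rot, A²], and A² differs from -1 only along Z, which `rot` kills.
  have hAB : A * B + B * A = 0 := by
    have e : A * B + B * A = rot * (A * A) - A * A * rot := by rw [hB]; noncomm_ring
    rw [e, h.sq, mul_add, add_mul, Matrix.mul_vecMulVec, Matrix.vecMulVec_mul, rot_mulVec_eZ,
      eZ_vecMul_rot]
    simp
  have hBA : B * A = -(A * B) := eq_neg_of_add_eq_zero_right hAB
  set C : Mat r := rot * B - B * rot with hC
  -- Leibniz rule: A C = [rot, A B] - [rot, A] B, whose first bracket is zero by harmonicity.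
  have hAC : A * C = -(B * B) := by
    have e : A * C = rot * (A * B) - A * B * rot - B * B := by
      rw [hC]
      conv_rhs => rw [show B * B = (rot * A - A * rot) * B by rw [hB]]
      noncomm_ring
    rw [e, hc, sub_self, zero_sub]
  have hCA : C * A = -(B * B) := by
    have e : C * A = rot * (B * A) - B * A * rot - B * B := by
      rw [hC]
      conv_rhs => rw [show B * B = B * (rot * A - A * rot) by rw [hB]]
      noncomm_ring
    rw [e, hBA, mul_neg, neg_mul, hc, sub_self, zero_sub]
  have hBZ : B *ᵥ eZ = 0 := by
    rw [hB, Matrix.sub_mulVec, ← Matrix.mulVec_mulVec, ← Matrix.mulVec_mulVec, rot_mulVec_eZ,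
      h.mulVec_eq_zero]
    simp
  have hCZ : C *ᵥ eZ = 0 := by
    rw [hC, Matrix.sub_mulVec, ← Matrix.mulVec_mulVec, ← Matrix.mulVec_mulVec, rot_mulVec_eZ, hBZ]
    simp
  have hCs : Cᵀ = -C := commutator_transpose hBs rot_transpose
  have hZC : eZ ᵥ* C = 0 := by rw [vecMul_of_skew hCs, hCZ, neg_zero]
  have hCC : A * (C * A) = -C := by
    rw [hCA, ← hAC, ← mul_assoc, h.sq, add_mul, Matrix.vecMulVec_mul, hZC]
    simp
  have hA'A : A * A' * A = Matrix.vecMulVec (A *ᵥ w') eZ + A' - Matrix.vecMulVec eZ (eZ ᵥ* A') := by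
    rw [mul_assoc, eq_sub_of_add_eq t.sq, mul_sub, mul_add, ← mul_assoc, h.sq, add_mul,
      Matrix.mul_vecMulVec, Matrix.mul_vecMulVec, h.mulVec_eq_zero, Matrix.vecMulVec_mul]
    simp
    abel
  clear_value B C
  have h1 : (C * A').trace = -(C * A').trace := by
    calc (C * A').trace = -((A * (C * A)) * A').trace := by rw [hCC]; simp
      _ = -(C * (A * A' * A)).trace := by
        rw [mul_assoc, Matrix.trace_mul_comm]; simp only [mul_assoc]
      _ = -(C * A').trace := by
        rw [hA'A, mul_sub, mul_add, Matrix.mul_vecMulVec, Matrix.mul_vecMulVec, hCZ,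
          Matrix.trace_sub, Matrix.trace_add, Matrix.trace_vecMulVec, dotProduct_comm,
          Matrix.dotProduct_mulVec, hZC]
        simp
  have h2 : frob B (rot * A' - A' * rot) = (C * A').trace := by
    have e1 : (rot * B * A').trace = (B * (A' * rot)).trace := by
      rw [mul_assoc, Matrix.trace_mul_comm, mul_assoc]
    rw [frob_eq_trace, commutator_transpose t.skew rot_transpose, hC, mul_neg, mul_sub, sub_mul,
      Matrix.trace_neg, Matrix.trace_sub, Matrix.trace_sub, e1, mul_assoc B rot A']
    ring
  rw [h2]
  linarith

theorem swapXY_single_iX (i : Fin r) :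
    swapXY (Pi.single (iX i) (1 : ℝ)) = Pi.single (iY i) 1 := by
  funext k
  rcases k with j | j | u <;> simp [swapXY, Pi.single_apply]

theorem swapXY_single_iY (i : Fin r) :
    swapXY (Pi.single (iY i) (1 : ℝ)) = Pi.single (iX i) 1 := by
  funext k
  rcases k with j | j | u <;> simp [swapXY, Pi.single_apply]

/-- `swapXY` permutes the horizontal basis, so the horizontal terms sum to a multiple of the
horizontal trace of A'A, which is the whole trace and vanishes. The direction Z is the only place
where harmonicity enters. -/
theorem sum_vertical_variation (h : IsLinearACM A eZ) (t : IsTangent A eZ A' w')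
    (hc : rot * (A * (rot * A - A * rot)) = A * (rot * A - A * rot) * rot) :
    ∑ i, (1 / 2 * frob (conn (Pi.single i 1) * A - A * conn (Pi.single i 1))
        (conn (Pi.single i 1) * A' - A' * conn (Pi.single i 1))
      + 3 * ((conn (Pi.single i 1) *ᵥ eZ) ⬝ᵥ (conn (Pi.single i 1) *ᵥ w'))) = 0 := by
  have hX : ∀ i : Fin r, (Pi.single (Sum.inl i) 1 : Idx r → ℝ) iZ = 0 := fun i => by simp
  have hY : ∀ i : Fin r, (Pi.single (Sum.inr (Sum.inl i)) 1 : Idx r → ℝ) iZ = 0 :=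
    fun i => by simp
  have hZ : frob (conn eZ * A - A * conn eZ) (conn eZ * A' - A' * conn eZ) = 0 := by
    rw [conn_eZ, Matrix.smul_mul, Matrix.mul_smul, ← smul_sub, frob_smul_left, Matrix.smul_mul,
      Matrix.mul_smul, ← smul_sub, frob_smul_right, frob_rot_rot_commutator h t hc]
    simp
  have hZ' : conn (eZ : Idx r → ℝ) *ᵥ eZ = 0 := by
    rw [conn_mulVec_eZ, swapXY_eZ, smul_zero]
  have htr := t.trace_mul
  have hAZ : (A' * A) iZ iZ = 0 := by
    rw [Matrix.mul_apply]
    simp [apply_iZ_right h]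
  simp only [Matrix.trace, Matrix.diag_apply, Fintype.sum_sum_type, Finset.univ_unique,
    Finset.sum_singleton, show (A' * A) (Sum.inr (Sum.inr default)) (Sum.inr (Sum.inr default)) = 0
      from hAZ] at htr
  simp only [Fintype.sum_sum_type, Finset.univ_unique, Finset.sum_singleton,
    show (Pi.single (Sum.inr (Sum.inr default)) 1 : Idx r → ℝ) = eZ from rfl,
    frob_conn_conn_commutator h t (hX _), frob_conn_conn_commutator h t (hY _),
    conn_eZ_dotProduct_conn t (hX _), conn_eZ_dotProduct_conn t (hY _), hZ, hZ',
    show ∀ i : Fin r, swapXY (Pi.single (Sum.inl i) (1 : ℝ)) = Pi.single (iY i) 1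
      from swapXY_single_iX,
    show ∀ i : Fin r, swapXY (Pi.single (Sum.inr (Sum.inl i)) (1 : ℝ)) = Pi.single (iX i) 1
      from swapXY_single_iY, Matrix.mulVec_single_one, single_one_dotProduct, Matrix.col_apply,
    zero_dotProduct, mul_zero, add_zero, mul_neg]
  rw [Finset.sum_neg_distrib, Finset.sum_neg_distrib, ← Finset.mul_sum, ← Finset.mul_sum,
    ← Finset.mul_sum, ← Finset.mul_sum]
  linarith

theorem bracket_single_iX (i : Fin r) (y : Idx r → ℝ) :
    bracket (Pi.single (iX i) 1) y = y iZ • Pi.single (iY i) (1 : ℝ) := by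
  funext k
  rcases k with j | j | u <;> simp [bracket, Pi.single_apply]

theorem bracket_single_iY (i : Fin r) (y : Idx r → ℝ) :
    bracket (Pi.single (iY i) 1) y = 0 := by
  funext k
  rcases k with j | j | u <;> simp [bracket]

theorem bracket_apply_iZ (a b : Idx r → ℝ) : bracket a b iZ = 0 := rfl

theorem sum_bracket_apply (y : Idx r → ℝ) : ∑ i, bracket (Pi.single i 1) y i = 0 := by
  refine Finset.sum_eq_zero fun i _ => ?_
  rcases i with i | i | u <;> simp [bracket]

/-- Each term vanishes. The bracket of X_i with y is a multiple of X_{r+i}, and the pairings reduce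
to inner products of orthogonal vectors; X_{r+i} is central; for Z the bracket is horizontal while
[∇_Z, A] kills Z. -/
theorem sum_horizontal_variation (h : IsLinearACM A eZ) (y : Idx r → ℝ) :
    ∑ i, (1 / 2 * frob (conn (Pi.single i 1) * A - A * conn (Pi.single i 1))
        (conn (bracket (Pi.single i 1) y) * A - A * conn (bracket (Pi.single i 1) y))
      + 3 * ((conn (Pi.single i 1) *ᵥ eZ) ⬝ᵥ (conn (bracket (Pi.single i 1) y) *ᵥ eZ))) = 0 := by
  refine Finset.sum_eq_zero fun i _ => ?_
  rcases i with i | i | u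
  · rw [show (Sum.inl i : Idx r) = iX i from rfl, bracket_single_iX, conn_smul,
      Matrix.smul_mul, Matrix.mul_smul, ← smul_sub, frob_smul_right, Matrix.smul_mulVec,
      dotProduct_smul, conn_mulVec_eZ, conn_mulVec_eZ, swapXY_single_iX, swapXY_single_iY,
      frob_conn_commutator h (by simp) (commutator_transpose h.skew (conn_transpose _)),
      conn_commutator_of_apply_iZ_eq_zero h (by simp), swapXY_single_iX, swapXY_single_iY,
      Matrix.smul_mulVec, Matrix.sub_mulVec, Matrix.vecMulVec_mulVec, Matrix.vecMulVec_mulVec,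
      Matrix.dotProduct_mulVec (A *ᵥ _), vecMul_of_skew h.skew, Matrix.mulVec_mulVec, h.sq,
      Matrix.add_mulVec, Matrix.vecMulVec_mulVec, Matrix.neg_mulVec, Matrix.one_mulVec]
    simp [apply_iZ_left h, eZ]
  · rw [show (Sum.inr (Sum.inl i) : Idx r) = iY i from rfl, bracket_single_iY, conn_zero]
    simp [frob]
  · rw [show (Pi.single (Sum.inr (Sum.inr u)) 1 : Idx r → ℝ) = eZ from rfl, frob_comm,
      frob_conn_commutator h (bracket_apply_iZ _ _)
        (commutator_transpose h.skew (conn_transpose _)), conn_mulVec_eZ eZ, swapXY_eZ, smul_zero,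
      zero_dotProduct, Matrix.dotProduct_mulVec,
      vecMul_of_skew (commutator_transpose h.skew (conn_transpose _)), Matrix.sub_mulVec,
      ← Matrix.mulVec_mulVec, ← Matrix.mulVec_mulVec, h.mulVec_eq_zero, conn_mulVec_eZ eZ,
      swapXY_eZ]
    simp

end

/-! ### Curves of matrices -/

/-- The curve `M` of matrices has derivative `M'` at `t`, entry by entry. -/
def HasEntryDerivAt (M : ℝ → Mat r) (M' : Mat r) (t : ℝ) : Prop :=
  ∀ l k, HasDerivAt (fun s => M s l k) (M' l k) t

section

variable {M N : ℝ → Mat r} {M' N' : Mat r} {u v : ℝ → Idx r → ℝ} {u' v' : Idx r → ℝ} {t : ℝ}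

theorem HasEntryDerivAt.add (hM : HasEntryDerivAt M M' t) (hN : HasEntryDerivAt N N' t) :
    HasEntryDerivAt (fun s => M s + N s) (M' + N') t := fun l k => (hM l k).add (hN l k)

theorem HasEntryDerivAt.sub (hM : HasEntryDerivAt M M' t) (hN : HasEntryDerivAt N N' t) :
    HasEntryDerivAt (fun s => M s - N s) (M' - N') t := fun l k => (hM l k).sub (hN l k)

theorem HasEntryDerivAt.mul (hM : HasEntryDerivAt M M' t) (hN : HasEntryDerivAt N N' t) :
    HasEntryDerivAt (fun s => M s * N s) (M' * N t + M t * N') t := by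
  intro l k
  simp only [Matrix.mul_apply, Matrix.add_apply, ← Finset.sum_add_distrib]
  exact HasDerivAt.fun_sum fun m _ => (hM l m).mul (hN m k)

theorem hasEntryDerivAt_const (M : Mat r) (t : ℝ) : HasEntryDerivAt (fun _ => M) 0 t :=
  fun l k => hasDerivAt_const t (M l k)

theorem HasEntryDerivAt.transpose (hM : HasEntryDerivAt M M' t) :
    HasEntryDerivAt (fun s => (M s)ᵀ) M'ᵀ t := fun l k => hM k l

theorem HasEntryDerivAt.neg (hM : HasEntryDerivAt M M' t) :
    HasEntryDerivAt (fun s => -M s) (-M') t := fun l k => (hM l k).neg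

theorem HasEntryDerivAt.vecMulVec (hu : HasDerivAt u u' t) (hv : HasDerivAt v v' t) :
    HasEntryDerivAt (fun s => Matrix.vecMulVec (u s) (v s))
      (Matrix.vecMulVec u' (v t) + Matrix.vecMulVec (u t) v') t := fun l k =>
  (hasDerivAt_pi.1 hu l).mul (hasDerivAt_pi.1 hv k)

theorem HasEntryDerivAt.mulVec (hM : HasEntryDerivAt M M' t) (hv : HasDerivAt v v' t) :
    HasDerivAt (fun s => M s *ᵥ v s) (M' *ᵥ v t + M t *ᵥ v') t := by
  refine hasDerivAt_pi.2 fun l => ?_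
  simp only [Matrix.mulVec, dotProduct, Pi.add_apply, ← Finset.sum_add_distrib]
  exact HasDerivAt.fun_sum fun m _ => (hM l m).mul (hasDerivAt_pi.1 hv m)

theorem HasDerivAt.dotProduct_pi (hu : HasDerivAt u u' t) (hv : HasDerivAt v v' t) :
    HasDerivAt (fun s => u s ⬝ᵥ v s) (u' ⬝ᵥ v t + u t ⬝ᵥ v') t := by
  simp only [dotProduct, ← Finset.sum_add_distrib]
  exact HasDerivAt.fun_sum fun m _ => (hasDerivAt_pi.1 hu m).mul (hasDerivAt_pi.1 hv m)

theorem HasEntryDerivAt.frob (hM : HasEntryDerivAt M M' t) (hN : HasEntryDerivAt N N' t) :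
    HasDerivAt (fun s => Heisenberg.frob (M s) (N s))
      (Heisenberg.frob M' (N t) + Heisenberg.frob (M t) N') t := by
  simp only [Heisenberg.frob, ← Finset.sum_add_distrib]
  exact HasDerivAt.fun_sum fun k _ => HasDerivAt.fun_sum fun l _ => (hM k l).mul (hN k l)

theorem hasEntryDerivAt_conn (hu : HasDerivAt u u' t) :
    HasEntryDerivAt (fun s => conn (u s)) (conn u') t := by
  intro l k
  rw [show (fun s => conn (u s) l k) = _ from funext fun s => conn_eq_sum (u s) l k,
    conn_eq_sum u']
  exact HasDerivAt.fun_sum fun i _ => (hasDerivAt_pi.1 hu i).mul_const _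

theorem HasEntryDerivAt.unique (hM : HasEntryDerivAt M M' t) (hN : HasEntryDerivAt M N' t) :
    M' = N' := by
  ext l k
  exact (hM l k).unique (hN l k)

theorem isTangent_of_hasDerivAt (h : ∀ s, IsLinearACM (M s) (u s)) (hM : HasEntryDerivAt M M' t)
    (hu : HasDerivAt u u' t) : IsTangent (M t) (u t) M' u' where
  skew := by
    have h1 := hM.transpose
    simp only [(h _).skew] at h1
    exact h1.unique hM.neg
  sq := by
    have h1 := hM.mul hM
    simp only [(h _).sq] at h1
    have h2 := (hasEntryDerivAt_const (-1) t).add (HasEntryDerivAt.vecMulVec hu hu)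
    rw [zero_add] at h2
    exact h1.unique h2
  unit := by
    have h1 := HasDerivAt.dotProduct_pi hu hu
    simp only [(h _).unit] at h1
    have h2 := h1.unique (hasDerivAt_const t (1 : ℝ))
    rw [dotProduct_comm u'] at h2
    linarith

end

/-! ### The energy density -/

section

variable {f : Pt r → QuotientBundle r}

theorem hasDerivAt_comp_line {g : Pt r → ℝ} {p : Pt r} (hg : DifferentiableAt ℝ g p) (v : Pt r) :
    HasDerivAt (fun s : ℝ => g (p + s • v)) (fderiv ℝ g p v) 0 := by
  have h := hg.hasFDerivAt.hasLineDerivAt v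
  exact h

/-- The derivative of the base map on `v`, in the left-invariant frame. -/
noncomputable def baseComp (f : Pt r → QuotientBundle r) (p v : Pt r) : Idx r → ℝ :=
  fun k => coframe k (f p).pt (baseDeriv f p v)

theorem connMatrix_baseDeriv (p v : Pt r) :
    connMatrix (f p).pt (baseDeriv f p v) = conn (baseComp f p v) := connMatrix_eq _ _

/-- The ordinary derivative is tangent because `f` stays in the space of structures along a line,
and the connection term because it is an infinitesimal rotation. -/
theorem isTangent_cov (hf : SmoothInto f) (p v : Pt r) :
    IsTangent (f p).phi (f p).zeta (covPhi f p v) (covZeta f p v) := by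
  have h1 : IsTangent (f (p + (0 : ℝ) • v)).phi (f (p + (0 : ℝ) • v)).zeta
      (Matrix.of fun l k => fderiv ℝ (fun q => (f q).phi l k) p v)
      (fun k => fderiv ℝ (fun q => (f q).zeta k) p v) :=
    isTangent_of_hasDerivAt (M := fun s : ℝ => (f (p + s • v)).phi)
      (u := fun s : ℝ => (f (p + s • v)).zeta) (fun s => (f (p + s • v)).isACM)
      (fun l k => hasDerivAt_comp_line ((hf.2.1 l k).differentiable (by simp) p) v)
      (hasDerivAt_pi.2 fun k => hasDerivAt_comp_line ((hf.2.2 k).differentiable (by simp) p) v)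
  rw [zero_smul, add_zero] at h1
  have h2 := isTangent_commutator (f p).isACM (conn_transpose (baseComp f p v))
  have h3 := h1.add h2
  rwa [← connMatrix_baseDeriv] at h3

theorem normSqDeriv_eq (hf : SmoothInto f) (p : Pt r) :
    normSqDeriv f p = ∑ i, (baseComp f p (frame i p) ⬝ᵥ baseComp f p (frame i p)
      + (1 / 4 * frob (covPhi f p (frame i p)) (covPhi f p (frame i p))
        + 3 / 2 * (covZeta f p (frame i p) ⬝ᵥ covZeta f p (frame i p)))) := by
  refine Finset.sum_congr rfl fun i _ => ?_
  rw [← (isTangent_cov hf p (frame i p)).frob_vert (f p).isACM]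
  simp only [frob, vertDeriv, pow_two]
  rfl

end

/-! ### Derivatives with respect to the parameter of a variation -/

section

variable {g : ℝ × Pt r → ℝ}

/-- The derivative at time zero. -/
noncomputable def timeDeriv (g : ℝ × Pt r → ℝ) (p : Pt r) : ℝ := fderiv ℝ g (0, p) (1, 0)

theorem hasDerivAt_slice (hg : ContDiff ℝ ∞ g) (t : ℝ) (p : Pt r) :
    HasDerivAt (fun s => g (s, p)) (fderiv ℝ g (t, p) (1, 0)) t := by
  have h := (hg.differentiable (by simp) (t, p)).hasFDerivAt
  exact h.comp_hasDerivAt t ((hasDerivAt_id t).prodMk (hasDerivAt_const t p))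

theorem fderiv_slice (hg : ContDiff ℝ ∞ g) (t : ℝ) (p v : Pt r) :
    fderiv ℝ (fun q => g (t, q)) p v = fderiv ℝ g (t, p) (0, v) := by
  have h := (hg.differentiable (by simp) (t, p)).hasFDerivAt
  have h2 := h.comp p ((hasFDerivAt_const t p).prodMk (hasFDerivAt_id p))
  have h3 : HasFDerivAt (fun q => g (t, q)) _ p := h2
  rw [h3.fderiv]
  simp

theorem contDiff_fderiv_slice (hg : ContDiff ℝ ∞ g) {V : Pt r → Pt r} (hV : ContDiff ℝ ∞ V) :
    ContDiff ℝ ∞ fun x : ℝ × Pt r => fderiv ℝ (fun q => g (x.1, q)) x.2 (V x.2) := by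
  simp only [fderiv_slice hg]
  exact (hg.fderiv_right (m := ∞) (by simp)).clm_apply
    (contDiff_const.prodMk (hV.comp contDiff_snd))

theorem contDiff_timeDeriv (hg : ContDiff ℝ ∞ g) : ContDiff ℝ ∞ (timeDeriv g) := by
  have h : ContDiff ℝ ∞ fun p : Pt r => ((0 : ℝ), p) := contDiff_const.prodMk contDiff_id
  exact ((hg.fderiv_right (m := ∞) (by simp)).comp h).clm_apply contDiff_const

theorem hasDerivAt_fderiv_slice (hg : ContDiff ℝ ∞ g) (p v : Pt r) :
    HasDerivAt (fun t => fderiv ℝ (fun q => g (t, q)) p v) (fderiv ℝ (timeDeriv g) p v) 0 := by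
  simp only [fderiv_slice hg]
  have h := ((hg.fderiv_right (m := ∞) (by simp)).differentiable (by simp)
    ((0 : ℝ), p)).hasFDerivAt
  have h1 := h.comp_hasDerivAt (0 : ℝ) ((hasDerivAt_id (0 : ℝ)).prodMk (hasDerivAt_const 0 p))
  have h2 := h1.clm_apply (hasDerivAt_const (0 : ℝ) ((0 : ℝ), v))
  have h3 := h.comp p ((hasFDerivAt_const (0 : ℝ) p).prodMk (hasFDerivAt_id p))
  have h4 := h3.clm_apply (hasFDerivAt_const ((1 : ℝ), (0 : Pt r)) p)
  have h5 : HasFDerivAt (timeDeriv g) _ p := h4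
  rw [h5.fderiv]
  -- Symmetry of the second derivative exchanges the time and space derivatives.
  have hs : IsSymmSndFDerivAt ℝ g (0, p) :=
    (hg.contDiffAt (x := ((0 : ℝ), p))).isSymmSndFDerivAt
      (by rw [minSmoothness_of_isRCLikeNormedField]; exact WithTop.coe_le_coe.2 le_top)
  refine HasDerivAt.congr_deriv h2 ?_
  simpa using hs (1, 0) (0, v)

theorem timeDeriv_eq_zero (hg : ContDiff ℝ ∞ g) {p : Pt r} (h : ∀ t, g (t, p) = g (0, p)) :
    timeDeriv g p = 0 := by
  have h1 := hasDerivAt_slice hg 0 p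
  rw [show (fun s => g (s, p)) = fun _ => g (0, p) from funext h] at h1
  exact h1.unique (hasDerivAt_const _ _)

theorem hasDerivAt_setIntegral (hg : ContDiff ℝ ∞ g) {K : Set (Pt r)} (hK : IsCompact K) :
    HasDerivAt (fun t => ∫ p in K, g (t, p)) (∫ p in K, timeDeriv g p) 0 := by
  have hc : Continuous fun x : ℝ × Pt r => fderiv ℝ g x (1, 0) :=
    ((hg.fderiv_right (m := ∞) (by simp)).clm_apply contDiff_const).continuous
  -- Any compact neighbourhood of time zero would serve; the constant dominates the time derivative
  -- on `K`.
  obtain ⟨C, hC⟩ := ((isCompact_Icc (a := (-1 : ℝ)) (b := 1)).prod hK).exists_bound_of_continuousOn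
    hc.continuousOn
  have hgt : ∀ t : ℝ, Continuous fun p => g (t, p) := fun t =>
    hg.continuous.comp (by fun_prop)
  have : IsFiniteMeasure (volume.restrict K) := ⟨by
    rw [Measure.restrict_apply_univ]; exact hK.measure_lt_top⟩
  refine (hasDerivAt_integral_of_dominated_loc_of_deriv_le (μ := volume.restrict K)
    (F := fun t p => g (t, p)) (F' := fun t p => fderiv ℝ g (t, p) (1, 0)) (bound := fun _ => C)
    (s := Set.Icc (-1) 1) (Icc_mem_nhds (by norm_num) (by norm_num)) ?_ ?_ ?_ ?_ ?_ ?_).2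
  · exact Filter.Eventually.of_forall fun t => (hgt t).aestronglyMeasurable
  · exact (hgt 0).continuousOn.integrableOn_compact hK
  · exact (hc.comp (by fun_prop : Continuous fun p : Pt r => ((0 : ℝ), p))).aestronglyMeasurable
  · exact (ae_restrict_iff' hK.measurableSet).2 (Filter.Eventually.of_forall fun p hp t ht =>
      hC (t, p) ⟨ht, hp⟩)
  · exact integrable_const _
  · exact Filter.Eventually.of_forall fun p t _ => hasDerivAt_slice hg t p

end

/-! ### Integration by parts -/

theorem integral_fderiv_apply_eq_zero {G : Pt r → ℝ} (hG : ContDiff ℝ ∞ G)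
    (hc : HasCompactSupport G) (v : Pt r) : ∫ p, fderiv ℝ G p v = 0 := by
  have h := integral_mul_fderiv_eq_neg_fderiv_mul_of_integrable (μ := (volume : Measure (Pt r)))
    (f := fun _ : Pt r => (1 : ℝ)) (g := G) (v := v) (by simp) ?_ ?_ (by simp) ?_
  · simpa using h
  · simp only [one_mul]
    refine Continuous.integrable_of_hasCompactSupport
      ((hG.fderiv_right (m := ∞) (by simp)).clm_apply contDiff_const).continuous ?_
    exact (hc.fderiv_apply ℝ v)
  · simp only [one_mul]
    exact hG.continuous.integrable_of_hasCompactSupport hc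
  · exact fun p _ => hG.differentiable (by simp) p

/-- The frame fields are divergence free for Lebesgue measure: in Z the coefficient x^j multiplies
∂/∂x^{r+j}, on whose variable it does not depend, so it moves inside the derivative. -/
theorem integral_fderiv_frame_eq_zero {G : Pt r → ℝ} (hG : ContDiff ℝ ∞ G)
    (hc : HasCompactSupport G) (i : Idx r) :
    Integrable (fun p => fderiv ℝ G p (frame i p)) ∧ ∫ p, fderiv ℝ G p (frame i p) = 0 := by
  have hint : ∀ {H : Pt r → ℝ}, ContDiff ℝ ∞ H → HasCompactSupport H → ∀ v : Pt r,
      Integrable fun p => fderiv ℝ H p v := fun hH hHc v =>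
    Continuous.integrable_of_hasCompactSupport
      ((hH.fderiv_right (m := ∞) (by simp)).clm_apply contDiff_const).continuous
      (hHc.fderiv_apply ℝ v)
  rcases i with i | i | u
  · exact ⟨hint hG hc _, integral_fderiv_apply_eq_zero hG hc _⟩
  · exact ⟨hint hG hc _, integral_fderiv_apply_eq_zero hG hc _⟩
  · have hH : ∀ j : Fin r, ContDiff ℝ ∞ fun p : Pt r => p (iX j) * G p := fun j =>
      (contDiff_apply ℝ ℝ (iX j)).mul hG
    have hHc : ∀ j : Fin r, HasCompactSupport fun p : Pt r => p (iX j) * G p := fun j =>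
      hc.mul_left
    have e : (fun p : Pt r => fderiv ℝ G p (frame (Sum.inr (Sum.inr u)) p))
        = fun p => fderiv ℝ G p (Pi.single iZ 1)
          + ∑ j, fderiv ℝ (fun q : Pt r => q (iX j) * G q) p (Pi.single (iY j) 1) := by
      funext p
      simp only [frame, map_add, map_sum, map_smul, smul_eq_mul]
      congr 1
      refine Finset.sum_congr rfl fun j _ => ?_
      rw [((hasFDerivAt_apply (𝕜 := ℝ) (iX j) p).fun_mul
        (hG.differentiable (by simp) p).hasFDerivAt).fderiv]
      simp
    rw [e]
    have h1 := integrable_finsetSum (Finset.univ : Finset (Fin r)) fun j _ =>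
      hint (hH j) (hHc j) (Pi.single (iY j) 1)
    refine ⟨(hint hG hc _).add h1, ?_⟩
    rw [integral_add (hint hG hc _) h1, integral_finsetSum _ fun j _ => hint (hH j) (hHc j) _,
      integral_fderiv_apply_eq_zero hG hc]
    simp [integral_fderiv_apply_eq_zero (hH _) (hHc _)]

/-! ### The first variation of the energy density -/

/-- The components along `e_i` of the vector field whose divergence is the first variation of the
energy density, as a linear form in the variation `(y, a, b)` of `(p, φ, ζ)`. -/
noncomputable def variationForm (A : Mat r) (i : Idx r) (y : Idx r → ℝ) (a : Mat r)
    (b : Idx r → ℝ) : ℝ :=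
  2 * y i + (1 / 2 * frob (conn (Pi.single i 1) * A - A * conn (Pi.single i 1))
      (a + (conn y * A - A * conn y))
    + 3 * ((conn (Pi.single i 1) *ᵥ eZ) ⬝ᵥ (b + conn y *ᵥ eZ)))

theorem frob_zero_left (M : Mat r) : frob 0 M = 0 := by simp [frob]

theorem hasDerivAt_variationForm (A : Mat r) (i : Idx r) {y b : ℝ → Idx r → ℝ} {a : ℝ → Mat r}
    {y' b' : Idx r → ℝ} {a' : Mat r} {t : ℝ} (hy : HasDerivAt y y' t)
    (ha : HasEntryDerivAt a a' t) (hb : HasDerivAt b b' t) :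
    HasDerivAt (fun s => variationForm A i (y s) (a s) (b s)) (variationForm A i y' a' b') t := by
  have hc := hasEntryDerivAt_conn hy
  have hA := hasEntryDerivAt_const A t
  have h1 := (hasEntryDerivAt_const (conn (Pi.single i 1) * A - A * conn (Pi.single i 1)) t).frob
    (ha.add ((hc.mul hA).sub (hA.mul hc)))
  have h2 := HasDerivAt.dotProduct_pi (hasDerivAt_const t (conn (Pi.single i 1) *ᵥ eZ))
    (hb.add (hc.mulVec (hasDerivAt_const t eZ)))
  have h3 := ((hasDerivAt_pi.1 hy i).const_mul 2).add
    ((h1.const_mul (1 / 2)).add (h2.const_mul 3))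
  refine HasDerivAt.congr_deriv h3 ?_
  simp only [variationForm, frob_zero_left, zero_dotProduct, mul_zero, zero_mul, add_zero,
    zero_add, Matrix.mulVec_zero]

/-- Here `y` stands for the derivative of the base variation along e_i and `c` for its bracket with
e_i. The terms in `y`, `DM'`, `Dw'` form the derivative of `variationForm`; the others are the
zero-order terms. -/
theorem hasDerivAt_density_term {A : Mat r} (i : Idx r) {θ w Dw : ℝ → Idx r → ℝ}
    {M DM : ℝ → Mat r} {y c w' Dw' : Idx r → ℝ} {M' DM' : Mat r}
    (hθ : HasDerivAt θ (y + c) 0) (hM : HasEntryDerivAt M M' 0) (hDM : HasEntryDerivAt DM DM' 0)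
    (hw : HasDerivAt w w' 0) (hDw : HasDerivAt Dw Dw' 0) (hθ0 : θ 0 = Pi.single i 1)
    (hM0 : M 0 = A) (hDM0 : DM 0 = 0) (hw0 : w 0 = eZ) (hDw0 : Dw 0 = 0) :
    HasDerivAt (fun s => θ s ⬝ᵥ θ s
        + (1 / 4 * frob (DM s + (conn (θ s) * M s - M s * conn (θ s)))
            (DM s + (conn (θ s) * M s - M s * conn (θ s)))
          + 3 / 2 * ((Dw s + conn (θ s) *ᵥ w s) ⬝ᵥ (Dw s + conn (θ s) *ᵥ w s))))
      (variationForm A i y DM' Dw' + 2 * c i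
        + (1 / 2 * frob (conn (Pi.single i 1) * A - A * conn (Pi.single i 1))
            (conn (Pi.single i 1) * M' - M' * conn (Pi.single i 1))
          + 3 * ((conn (Pi.single i 1) *ᵥ eZ) ⬝ᵥ (conn (Pi.single i 1) *ᵥ w')))
        + (1 / 2 * frob (conn (Pi.single i 1) * A - A * conn (Pi.single i 1))
            (conn c * A - A * conn c)
          + 3 * ((conn (Pi.single i 1) *ᵥ eZ) ⬝ᵥ (conn c *ᵥ eZ)))) 0 := by
  have hc := hasEntryDerivAt_conn hθ
  have hC := hDM.add ((hc.mul hM).sub (hM.mul hc))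
  have hv := hDw.add (hc.mulVec hw)
  have h := (HasDerivAt.dotProduct_pi hθ hθ).add (((hC.frob hC).const_mul (1 / 4)).add
    ((HasDerivAt.dotProduct_pi hv hv).const_mul (3 / 2)))
  refine HasDerivAt.congr_deriv h ?_
  simp only [Pi.add_apply, hθ0, hM0, hDM0, hw0, hDw0, zero_add]
  -- The two halves of each product rule agree by symmetry, which doubles ¼ and 3/2 to ½ and 3.
  rw [frob_comm (_ + _) (conn _ * A - _), dotProduct_comm (_ + _) (conn _ *ᵥ eZ)]
  simp only [variationForm, conn_add, add_mul, mul_add, Matrix.add_mulVec, frob_add_right,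
    frob_sub_right, dotProduct_add, dotProduct_single, single_dotProduct,
    Pi.add_apply]
  ring

theorem contDiff_frame (i : Idx r) : ContDiff ℝ ∞ (frame i : Pt r → Pt r) := by
  rw [frame_eq_leftField]
  refine contDiff_pi.2 fun l => ?_
  rcases l with j | j | u
  · simp only [leftField_apply_iX]
    exact contDiff_const
  · simp only [leftField_apply_iY]
    exact contDiff_const.add ((contDiff_apply ℝ ℝ (iX j)).mul contDiff_const)
  · rw [show (fun p => leftField (Pi.single i (1 : ℝ)) p (Sum.inr (Sum.inr u))) = _ from
      funext fun p => leftField_apply_iZ (Pi.single i (1 : ℝ)) p]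
    exact contDiff_const

theorem baseDeriv_apply {f : Pt r → QuotientBundle r} (hf : SmoothInto f) (p v : Pt r)
    (l : Idx r) : baseDeriv f p v l = fderiv ℝ (fun q => (f q).pt l) p v := by
  have h := (hasFDerivAt_pi'.1 (hf.1.differentiable (by simp) p).hasFDerivAt l).fderiv
  rw [h]
  rfl

theorem SmoothInto.slice {F : ℝ → Pt r → QuotientBundle r}
    (hF : SmoothInto fun x : ℝ × Pt r => F x.1 x.2) (t : ℝ) : SmoothInto (F t) := by
  have h : ContDiff ℝ ∞ fun p : Pt r => (t, p) := contDiff_const.prodMk contDiff_id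
  exact ⟨hF.1.comp h, fun l k => (hF.2.1 l k).comp h, fun k => (hF.2.2 k).comp h⟩

theorem SmoothInto.pt_apply {E : Type*} [NormedAddCommGroup E] [NormedSpace ℝ E]
    {f : E → QuotientBundle r} (hf : SmoothInto f) (l : Idx r) :
    ContDiff ℝ ∞ fun x => (f x).pt l := contDiff_pi.1 hf.1 l

/-! ### First variation of the energy along a smooth family -/

section Variation

variable {F : ℝ → Pt r → QuotientBundle r}

/-- The variation of the base map, in the left-invariant frame. -/
noncomputable def ptVariation (F : ℝ → Pt r → QuotientBundle r) (p : Pt r) : Idx r → ℝ :=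
  fun k => coframe k p fun l => timeDeriv (fun x => (F x.1 x.2).pt l) p

/-- The variation of the endomorphism part. -/
noncomputable def phiVariation (F : ℝ → Pt r → QuotientBundle r) (p : Pt r) : Mat r :=
  Matrix.of fun l k => timeDeriv (fun x => (F x.1 x.2).phi l k) p

/-- The variation of the vector part. -/
noncomputable def zetaVariation (F : ℝ → Pt r → QuotientBundle r) (p : Pt r) : Idx r → ℝ :=
  fun k => timeDeriv (fun x => (F x.1 x.2).zeta k) p

theorem contDiff_coframe {E : Type*} [NormedAddCommGroup E] [NormedSpace ℝ E]
    {u v : E → Pt r} (hu : ∀ l, ContDiff ℝ ∞ fun x => u x l) (hv : ∀ l, ContDiff ℝ ∞ fun x => v x l)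
    (k : Idx r) : ContDiff ℝ ∞ fun x => coframe k (u x) (v x) := by
  rcases k with i | i | a
  · exact hv _
  · exact (hv _).sub ((hu _).mul (hv _))
  · exact hv _

theorem contDiff_ptVariation (hF : SmoothInto fun x : ℝ × Pt r => F x.1 x.2) (k : Idx r) :
    ContDiff ℝ ∞ fun p => ptVariation F p k :=
  contDiff_coframe (fun l => contDiff_apply ℝ ℝ l)
    (fun l => contDiff_timeDeriv (hF.pt_apply l)) k

/-- This is the Lie derivative of the coframe along the variation field Y, evaluated on the
left-invariant field with components `a`: the components of its bracket with Y, namely the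
derivative of those of Y plus the structure-constant term. -/
theorem hasDerivAt_baseComp (hF : SmoothInto fun x : ℝ × Pt r => F x.1 x.2)
    (h0 : ∀ p, (F 0 p).pt = p) (a : Idx r → ℝ) (p : Pt r) :
    HasDerivAt (fun t => baseComp (F t) p (leftField a p))
      ((fun k => fderiv ℝ (fun q => ptVariation F q k) p (leftField a p))
        + bracket a (ptVariation F p)) 0 := by
  have hD := fun l => hasDerivAt_fderiv_slice (hF.pt_apply l) p (leftField a p)
  have hd := fun l => hasDerivAt_slice (hF.pt_apply l) 0 p
  have e0 : ∀ l, fderiv ℝ (fun q => (F 0 q).pt l) p (leftField a p) = leftField a p l := by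
    intro l
    simp only [h0]
    rw [(hasFDerivAt_apply l p).fderiv]
    rfl
  refine hasDerivAt_pi.2 fun k => ?_
  rcases k with j | j | u
  · simp only [baseComp, coframe, baseDeriv_apply (hF.slice _)]
    simpa [ptVariation, coframe, bracket] using hD (iX j)
  · simp only [baseComp, coframe, baseDeriv_apply (hF.slice _)]
    have h1 := (hD (iY j)).sub ((hd (iX j)).mul (hD iZ))
    refine HasDerivAt.congr_deriv h1 ?_
    have h2 := ((contDiff_timeDeriv (hF.pt_apply (iY j))).differentiable (by simp) p).hasFDerivAt.sub
      ((hasFDerivAt_apply (𝕜 := ℝ) (iX j) p).mul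
        ((contDiff_timeDeriv (hF.pt_apply iZ)).differentiable (by simp) p).hasFDerivAt)
    have h3 : HasFDerivAt (fun q => ptVariation F q (iY j)) _ p := h2
    simp only [Pi.add_apply]
    rw [show (fun q => ptVariation F q (Sum.inr (Sum.inl j))) = fun q => ptVariation F q (iY j)
      from rfl, h3.fderiv]
    simp only [e0]
    simp only [h0, leftField_apply_iZ, bracket, ptVariation, coframe]
    simp [leftField_apply_iX, timeDeriv]
    ring
  · simp only [baseComp, coframe, baseDeriv_apply (hF.slice _)]
    simpa [ptVariation, coframe, bracket] using hD iZ

theorem contDiff_baseComp (hF : SmoothInto fun x : ℝ × Pt r => F x.1 x.2) (i k : Idx r) :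
    ContDiff ℝ ∞ fun x : ℝ × Pt r => baseComp (F x.1) x.2 (frame i x.2) k := by
  refine contDiff_coframe hF.pt_apply (fun l => ?_) k
  simp only [baseDeriv_apply (hF.slice _)]
  exact contDiff_fderiv_slice (hF.pt_apply l) (contDiff_frame i)

theorem contDiff_normSqDeriv (hF : SmoothInto fun x : ℝ × Pt r => F x.1 x.2) :
    ContDiff ℝ ∞ fun x : ℝ × Pt r => normSqDeriv (F x.1) x.2 := by
  have hconn : ∀ i l k : Idx r, ContDiff ℝ ∞ fun x : ℝ × Pt r =>
      conn (baseComp (F x.1) x.2 (frame i x.2)) l k := by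
    intro i l k
    rw [funext fun x : ℝ × Pt r => conn_eq_sum (baseComp (F x.1) x.2 (frame i x.2)) l k]
    exact ContDiff.sum fun j _ => (contDiff_baseComp hF i j).mul contDiff_const
  have hphi : ∀ i l k : Idx r, ContDiff ℝ ∞ fun x : ℝ × Pt r =>
      covPhi (F x.1) x.2 (frame i x.2) l k := by
    intro i l k
    simp only [covPhi, connMatrix_baseDeriv, Matrix.add_apply, Matrix.sub_apply, Matrix.mul_apply,
      Matrix.of_apply]
    exact (contDiff_fderiv_slice (hF.2.1 l k) (contDiff_frame i)).add
      ((ContDiff.sum fun j _ => (hconn i l j).mul (hF.2.1 j k)).sub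
        (ContDiff.sum fun j _ => (hF.2.1 l j).mul (hconn i j k)))
  have hzeta : ∀ i k : Idx r, ContDiff ℝ ∞ fun x : ℝ × Pt r =>
      covZeta (F x.1) x.2 (frame i x.2) k := by
    intro i k
    simp only [covZeta, connMatrix_baseDeriv, Pi.add_apply, Matrix.mulVec, dotProduct]
    exact (contDiff_fderiv_slice (hF.2.2 k) (contDiff_frame i)).add
      (ContDiff.sum fun j _ => (hconn i k j).mul (hF.2.2 j))
  simp only [normSqDeriv_eq (hF.slice _), frob, dotProduct]
  exact ContDiff.sum fun i _ =>
    (ContDiff.sum fun k _ => (contDiff_baseComp hF i k).mul (contDiff_baseComp hF i k)).add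
      ((contDiff_const.mul (ContDiff.sum fun l _ => ContDiff.sum fun k _ =>
        (hphi i l k).mul (hphi i l k))).add
      (contDiff_const.mul (ContDiff.sum fun k _ => (hzeta i k).mul (hzeta i k))))

theorem contDiff_variationForm (hF : SmoothInto fun x : ℝ × Pt r => F x.1 x.2) (A : Mat r)
    (i : Idx r) : ContDiff ℝ ∞ fun p =>
      variationForm A i (ptVariation F p) (phiVariation F p) (zetaVariation F p) := by
  have hconn : ∀ l k : Idx r, ContDiff ℝ ∞ fun p => conn (ptVariation F p) l k := by
    intro l k
    rw [funext fun p : Pt r => conn_eq_sum (ptVariation F p) l k]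
    exact ContDiff.sum fun j _ => (contDiff_ptVariation hF j).mul contDiff_const
  have h1 : ∀ l k : Idx r, ContDiff ℝ ∞ fun p => (conn (ptVariation F p) * A) l k := by
    intro l k
    simp only [Matrix.mul_apply]
    exact ContDiff.sum fun j _ => (hconn l j).mul contDiff_const
  have h2 : ∀ l k : Idx r, ContDiff ℝ ∞ fun p => (A * conn (ptVariation F p)) l k := by
    intro l k
    simp only [Matrix.mul_apply]
    exact ContDiff.sum fun j _ => contDiff_const.mul (hconn j k)
  have h3 : ∀ k : Idx r, ContDiff ℝ ∞ fun p => (conn (ptVariation F p) *ᵥ eZ) k := by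
    intro k
    simp only [Matrix.mulVec, dotProduct]
    exact ContDiff.sum fun j _ => (hconn k j).mul contDiff_const
  simp only [variationForm, frob, dotProduct, Matrix.add_apply, Matrix.sub_apply, Pi.add_apply]
  exact (contDiff_const.mul (contDiff_ptVariation hF i)).add ((contDiff_const.mul
    (ContDiff.sum fun l _ => ContDiff.sum fun k _ => contDiff_const.mul
      ((contDiff_timeDeriv (hF.2.1 l k)).add ((h1 l k).sub (h2 l k))))).add
    (contDiff_const.mul (ContDiff.sum fun k _ =>
      contDiff_const.mul ((contDiff_timeDeriv (hF.2.2 k)).add (h3 k)))))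

theorem fderiv_variationForm (hF : SmoothInto fun x : ℝ × Pt r => F x.1 x.2) (A : Mat r)
    (i : Idx r) (p v : Pt r) :
    fderiv ℝ (fun p => variationForm A i (ptVariation F p) (phiVariation F p)
        (zetaVariation F p)) p v
      = variationForm A i (fun k => fderiv ℝ (fun q => ptVariation F q k) p v)
          (Matrix.of fun l k => fderiv ℝ (fun q => phiVariation F q l k) p v)
          (fun k => fderiv ℝ (fun q => zetaVariation F q k) p v) := by
  have h1 := hasDerivAt_comp_line ((contDiff_variationForm hF A i).differentiable (by simp) p) v
  refine h1.unique (hasDerivAt_variationForm A i ?_ ?_ ?_)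
  · exact hasDerivAt_pi.2 fun k => hasDerivAt_comp_line
      ((contDiff_ptVariation hF k).differentiable (by simp) p) v
  · exact fun l k => hasDerivAt_comp_line
      ((contDiff_timeDeriv (hF.2.1 l k)).differentiable (by simp) p) v
  · exact hasDerivAt_pi.2 fun k => hasDerivAt_comp_line
      ((contDiff_timeDeriv (hF.2.2 k)).differentiable (by simp) p) v

/-- Under the harmonicity equation all zero-order terms cancel pointwise, and the first variation is
a pure divergence. The base term 2∑ [e_i, Y]_i vanishes because the group is unimodular. -/
theorem timeDeriv_normSqDeriv (hF : SmoothInto fun x : ℝ × Pt r => F x.1 x.2) {A : Mat r}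
    (hpt : ∀ p, (F 0 p).pt = p) (hphi : ∀ p, (F 0 p).phi = A) (hzeta : ∀ p, (F 0 p).zeta = eZ)
    (hc : rot * (A * (rot * A - A * rot)) = A * (rot * A - A * rot) * rot) (p : Pt r) :
    timeDeriv (fun x : ℝ × Pt r => normSqDeriv (F x.1) x.2) p
      = ∑ i, fderiv ℝ (fun p => variationForm A i (ptVariation F p) (phiVariation F p)
          (zetaVariation F p)) p (frame i p) := by
  have hA : IsLinearACM A eZ := by
    have h := (F 0 0).isACM
    rwa [hphi, hzeta] at h
  have hM : HasEntryDerivAt (fun t => (F t p).phi) (phiVariation F p) 0 := fun l k =>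
    hasDerivAt_slice (hF.2.1 l k) 0 p
  have hw : HasDerivAt (fun t => (F t p).zeta) (zetaVariation F p) 0 :=
    hasDerivAt_pi.2 fun k => hasDerivAt_slice (hF.2.2 k) 0 p
  have ht : IsTangent A eZ (phiVariation F p) (zetaVariation F p) := by
    have h := isTangent_of_hasDerivAt (fun t => (F t p).isACM) hM hw
    rwa [hphi, hzeta] at h
  have hi := fun i => hasDerivAt_density_term (A := A) i
    (θ := fun t => baseComp (F t) p (frame i p))
    (DM := fun t => Matrix.of fun l k => fderiv ℝ (fun q => (F t q).phi l k) p (frame i p))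
    (Dw := fun t k => fderiv ℝ (fun q => (F t q).zeta k) p (frame i p))
    (y := fun k => fderiv ℝ (fun q => ptVariation F q k) p (frame i p))
    (c := bracket (Pi.single i 1) (ptVariation F p))
    (DM' := Matrix.of fun l k => fderiv ℝ (fun q => phiVariation F q l k) p (frame i p))
    (Dw' := fun k => fderiv ℝ (fun q => zetaVariation F q k) p (frame i p))
    (by
      rw [frame_eq_leftField]
      exact hasDerivAt_baseComp hF hpt _ p)
    hM (fun l k => hasDerivAt_fderiv_slice (hF.2.1 l k) p (frame i p)) hw
    (hasDerivAt_pi.2 fun k => hasDerivAt_fderiv_slice (hF.2.2 k) p (frame i p))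
    (by
      funext k
      simp only [baseComp, baseDeriv, hpt]
      rw [fderiv_fun_id, ContinuousLinearMap.id_apply, coframe_frame, Pi.single_apply])
    (hphi p) (by ext l k; simp [hphi]) (hzeta p) (by funext k; simp [hzeta])
  have h := HasDerivAt.fun_sum fun i (_ : i ∈ Finset.univ) => hi i
  have h' := hasDerivAt_slice (contDiff_normSqDeriv hF) 0 p
  simp only [normSqDeriv_eq (hF.slice _), covPhi, covZeta, connMatrix_baseDeriv] at h'
  have h2 := h'.unique h
  simp only [fderiv_variationForm hF]
  rw [Finset.sum_add_distrib, Finset.sum_add_distrib, Finset.sum_add_distrib,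
    sum_vertical_variation hA ht hc, sum_horizontal_variation hA, ← Finset.mul_sum,
    sum_bracket_apply, mul_zero, add_zero, add_zero, add_zero] at h2
  rw [← h2, timeDeriv]
  simp only [normSqDeriv_eq (hF.slice _), covPhi, covZeta, connMatrix_baseDeriv]

theorem hasDerivAt_energy (hF : SmoothInto fun x : ℝ × Pt r => F x.1 x.2) {A : Mat r}
    (hpt : ∀ p, (F 0 p).pt = p) (hphi : ∀ p, (F 0 p).phi = A) (hzeta : ∀ p, (F 0 p).zeta = eZ)
    (hc : rot * (A * (rot * A - A * rot)) = A * (rot * A - A * rot) * rot)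
    {K : Set (Pt r)} (hK : IsCompact K) (hFK : ∀ t, ∀ p, p ∉ K → F t p = F 0 p) :
    HasDerivAt (fun t => energy K (F t)) 0 0 := by
  have h := (hasDerivAt_setIntegral (contDiff_normSqDeriv hF) hK).const_mul (1 / 2)
  refine HasDerivAt.congr_deriv h ?_
  have hG := contDiff_variationForm hF A
  have hG0 : ∀ i, ∀ p ∉ K, variationForm A i (ptVariation F p) (phiVariation F p)
      (zetaVariation F p) = 0 := by
    intro i p hp
    have h1 : ptVariation F p = 0 := by
      funext k
      have e : (fun l => timeDeriv (fun x => (F x.1 x.2).pt l) p) = (0 : Pt r) :=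
        funext fun l => timeDeriv_eq_zero (hF.pt_apply l) fun t => by
          change (F t p).pt l = (F 0 p).pt l
          rw [hFK t p hp]
      rw [ptVariation, e]
      rcases k with j | j | u <;> simp [coframe]
    have h2 : phiVariation F p = 0 := by
      ext l k
      exact timeDeriv_eq_zero (hF.2.1 l k) fun t => by
        change (F t p).phi l k = (F 0 p).phi l k
        rw [hFK t p hp]
    have h3 : zetaVariation F p = 0 := by
      funext k
      exact timeDeriv_eq_zero (hF.2.2 k) fun t => by
        change (F t p).zeta k = (F 0 p).zeta k
        rw [hFK t p hp]
    rw [h1, h2, h3]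
    simp [variationForm, conn_zero, frob]
  have hGc := fun i => HasCompactSupport.intro hK (hG0 i)
  have hint := fun i => integral_fderiv_frame_eq_zero (hG i) (hGc i) i
  -- The first variation vanishes off `K`, so the integral extends to the whole space, where
  -- integration by parts has no boundary term.
  rw [setIntegral_eq_integral_of_forall_compl_eq_zero]
  · simp only [timeDeriv_normSqDeriv hF hpt hphi hzeta hc]
    rw [integral_finsetSum _ fun i _ => (hint i).1, Finset.sum_eq_zero fun i _ => (hint i).2,
      mul_zero]
  · intro p hp
    rw [timeDeriv_normSqDeriv hF hpt hphi hzeta hc]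
    refine Finset.sum_eq_zero fun i _ => ?_
    have hz : (fun q => variationForm A i (ptVariation F q) (phiVariation F q)
        (zetaVariation F q)) =ᶠ[nhds p] fun _ => 0 := by
      filter_upwards [hK.isClosed.isOpen_compl.mem_nhds hp] with q hq using hG0 i q hq
    rw [hz.fderiv_eq]
    simp

end Variation

namespace AlmostContactMetric

variable {S : AlmostContactMetric r}

theorem isHarmonicMap_toSection (hinv : S.IsLeftInvariant) (hζ : ∀ p, S.ζ p = frame iZ p)
    (h : S.IsHarmonic) : IsHarmonicMap S.toSection := by
  have hphi : ∀ p, (S.toSection p).phi = S.phiMatrix := fun p => by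
    ext l k
    exact hinv.comp_eq l k p
  have hzeta : ∀ p, (S.toSection p).zeta = eZ := compZeta_eq hζ
  refine ⟨⟨contDiff_id, fun l k => ?_, fun k => ?_⟩, fun F hF hF0 K hK hFK => ?_⟩
  · simp only [hphi]
    exact contDiff_const
  · simp only [hzeta]
    exact contDiff_const
  · exact hasDerivAt_energy hF (fun p => by rw [hF0]; rfl) (fun p => by rw [hF0, hphi])
      (fun p => by rw [hF0, hzeta]) ((isHarmonic_iff hinv hζ).1 h) hK
      (fun t p hp => by rw [hFK t p hp, hF0])

end AlmostContactMetric

end Heisenberg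

theorem mainTheorem11 (r : ℕ) (S : Heisenberg.AlmostContactMetric r)
    (hinv : S.IsLeftInvariant)
    (hζ : ∀ p, S.ζ p = Heisenberg.frame Heisenberg.iZ p) :
    (S.IsHarmonic → Heisenberg.IsHarmonicMap S.toSection) ∧
    List.TFAE [
      S.IsHarmonic,
      ∀ (p : Heisenberg.Pt r) (i j : Fin r),
        Heisenberg.metric p
            (S.xi (Heisenberg.frame Heisenberg.iZ) (Heisenberg.frame (Heisenberg.iX i)) p)
            (Heisenberg.frame (Heisenberg.iX j) p)
          = Heisenberg.metric p
            (S.xi (Heisenberg.frame Heisenberg.iZ) (Heisenberg.frame (Heisenberg.iY i)) p)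
            (Heisenberg.frame (Heisenberg.iY j) p) ∧
        Heisenberg.metric p
            (S.xi (Heisenberg.frame Heisenberg.iZ) (Heisenberg.frame (Heisenberg.iX i)) p)
            (Heisenberg.frame (Heisenberg.iY j) p)
          = Heisenberg.metric p
            (S.xi (Heisenberg.frame Heisenberg.iZ) (Heisenberg.frame (Heisenberg.iX j)) p)
            (Heisenberg.frame (Heisenberg.iY i) p),
      ∀ (p : Heisenberg.Pt r) (i j : Fin r),
        ∑ k : Fin r,
          ((S.comp (Heisenberg.iY k) (Heisenberg.iX j) p
              + S.comp (Heisenberg.iX k) (Heisenberg.iY j) p)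
            * (S.comp (Heisenberg.iX k) (Heisenberg.iX i) p
              + S.comp (Heisenberg.iY k) (Heisenberg.iY i) p)
          + (S.comp (Heisenberg.iY k) (Heisenberg.iY j) p
              - S.comp (Heisenberg.iX k) (Heisenberg.iX j) p)
            * (S.comp (Heisenberg.iY k) (Heisenberg.iX i) p
              - S.comp (Heisenberg.iX k) (Heisenberg.iY i) p)) = 0 ∧
        ∑ k : Fin r,
          (S.comp (Heisenberg.iX k) (Heisenberg.iX i) p
              * S.comp (Heisenberg.iY k) (Heisenberg.iY j) p
            - S.comp (Heisenberg.iY k) (Heisenberg.iX i) p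
              * S.comp (Heisenberg.iX k) (Heisenberg.iY j) p
            + S.comp (Heisenberg.iY k) (Heisenberg.iX j) p
              * S.comp (Heisenberg.iX k) (Heisenberg.iY i) p
            - S.comp (Heisenberg.iX k) (Heisenberg.iX j) p
              * S.comp (Heisenberg.iY k) (Heisenberg.iY i) p) = 0] := by
  have hA := Heisenberg.AlmostContactMetric.isLinearACM_phiMatrix hζ
  refine ⟨S.isHarmonicMap_toSection hinv hζ, ?_⟩
  have h12 := (S.isHarmonic_iff hinv hζ).trans (Heisenberg.rot_mul_rot_commutator_iff hA)
  tfae_have 1 ↔ 2 := by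
    rw [h12]
    simp only [Heisenberg.AlmostContactMetric.metric_xi_frame_iZ hinv hζ, neg_inj,
      mul_right_inj' (show (1 / 4 : ℝ) ≠ 0 by norm_num)]
    -- By left invariance the condition does not depend on the point.
    exact ⟨fun h _ => h, fun h => h 0⟩
  tfae_have 1 ↔ 3 := by
    rw [h12]
    simp only [Heisenberg.mul_rot_commutator_components_iff hA, hinv.comp_eq]
    exact ⟨fun h _ => h, fun h => h 0⟩
  tfae_finish
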